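/- Let $G$ be a finite, simple, connected graph on $n$ vertices. In the asynchronous push\&pull protocol every vertex has an independent exponential clock of rate $1$ and initially only one vertex $v$ knows a rumour. Whenever the clock of a vertex $x$ rings, $x$ calls a uniformly random neighbour $y$ (independently of everything else); if exactly one of $x,y$ knows the rumour at that moment, the other learns it (a push if $x$ knows it, a pull if $y$ knows it). In the pull-only protocol only pulls transmit the rumour. The spread time from $v$ is the first time at which all vertices know the rumour. The average spread time $\mathrm{avg}(G)$ is the smallest $t$ such that for every starting vertex $v$ the expected spread time from $v$ is at most $t$; the guaranteed spread time $\mathrm{gst}(G)$ is the smallest $t$ such that for every starting vertex $v$ the spread time from $v$ exceeds $t$ with probability at most $1/n$. Write $\mathrm{avg}$, $\mathrm{gst}$ for these quantities for push\&pull and $\mathrm{avg}^{\mathrm{pull}}$ for the average spread time of the pull-only protocol; $\log$ is the natural logarithm. There is a constant $N$ such that for every $n\ge N$ and every connected $n$-vertex graph $G$, $$\Bigl(1-\frac1n\Bigr)\mathrm{avg}(G)\le \mathrm{gst}(G)\le e\,\mathrm{avg}(G)\log n,$$ $$\frac15\log n<\mathrm{avg}(G)<4n,\qquad \mathrm{avg}^{\mathrm{pull}}(G)<4n,$$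 $$\frac15\log n\le \mathrm{gst}(G)\le 4e\,n\log n .$$ Moreover, all these bounds are tight up to constant factors: there are constants $C,c>0$ such that for all large enough $n$ the following hold. - For the star $S_n$ on $n$ vertices: $\mathrm{gst}(S_n)\le C\,\mathrm{avg}(S_n)$, $\mathrm{avg}(S_n)\le C\log n$ and $\mathrm{gst}(S_n)\le C\log n$. - For the path $P_n$ on $n$ vertices: $\mathrm{avg}(P_n)\ge c\,n$ and $\mathrm{avg}^{\mathrm{pull}}(P_n)\ge c\,n$. - For the double star $D_n$ on $n$ vertices (two adjacent centres, with the other $n-2$ vertices attached to them as leaves, split as equally as possible between the two centres), which is connected: $\mathrm{gst}(D_n)\ge c\,\mathrm{avg}(D_n)\log n$ and $\mathrm{gst}(D_n)\ge c\,n\log n$. -/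

import Mathlib

open MeasureTheory ProbabilityTheory Filter
open scoped ENNReal NNReal

namespace Rumour

/-- The two asynchronous protocols: in `pushPull`, a call transmits the rumour in either direction;
in `pullOnly`, only the caller can learn the rumour. -/
inductive Protocol
  | pushPull
  | pullOnly

section Randomness

variable {V : Type*} [Fintype V]

open Classical in
/-- The law of the neighbour called by `x`: uniform on the neighbours of `x`. (A vertex without
neighbours calls itself, which has no effect.) -/
noncomputable def callPMF (G : SimpleGraph V) (x : V) : PMF V :=
  if h : (Finset.univ.filter (G.Adj x)).Nonempty then PMF.uniformOfFinset _ h else PMF.pure x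

/-- A realization of the randomness: `(ω (x, k)).1` is the waiting time between the `k`-th ring and
the next ring of the clock of `x` (from time `0` to the first ring for `k = 0`), and `(ω (x, k)).2`
is the vertex that `x` calls at the end of this waiting time. -/
abbrev Realization (V : Type*) := V × ℕ → ℝ × V

/-- The law of the randomness: all waiting times and all called vertices are independent, the
waiting times are exponential of rate `1`, and the vertices that `x` calls are uniformly random
neighbours of `x`. -/
noncomputable def law [MeasurableSpace V] (G : SimpleGraph V) : Measure (Realization V) :=
  Measure.infinitePi fun p : V × ℕ => (expMeasure 1).prod (callPMF G p.1).toMeasure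

/-- The law of the randomness is a probability measure. -/
instance [MeasurableSpace V] (G : SimpleGraph V) : IsProbabilityMeasure (law G) := by
  have : IsProbabilityMeasure (expMeasure 1) := isProbabilityMeasure_expMeasure one_pos
  unfold law
  infer_instance

end Randomness

section Spreading

variable {V : Type*}

/-- The time at which the clock of `x` rings for the `k`-th time (counting from `k = 0`). -/
noncomputable def ringTime (ω : Realization V) (x : V) (k : ℕ) : ℝ :=
  ∑ j ∈ Finset.range (k + 1), (ω (x, j)).1

/-- `Informed P ω v y t`: in the realization `ω` of the protocol `P` with the rumour starting at
`v`, the vertex `y` knows the rumour at time `t`. -/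
inductive Informed (P : Protocol) (ω : Realization V) (v : V) : V → ℝ → Prop
  /-- The initial vertex knows the rumour from time `0` on. -/
  | source (t : ℝ) (ht : 0 ≤ t) : Informed P ω v v t
  /-- When an informed vertex `x` calls a vertex, the latter learns the rumour. -/
  | push (x : V) (k : ℕ) (s t : ℝ) (hP : P = Protocol.pushPull) (hx : Informed P ω v x s)
      (hs : s < ringTime ω x k) (ht : ringTime ω x k ≤ t) : Informed P ω v (ω (x, k)).2 t
  /-- When a vertex `x` calls an informed vertex, `x` learns the rumour. -/
  | pull (x : V) (k : ℕ) (s t : ℝ) (hy : Informed P ω v (ω (x, k)).2 s)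
      (hs : s < ringTime ω x k) (ht : ringTime ω x k ≤ t) : Informed P ω v x t

/-- The spread time from `v`: the first time at which all vertices know the rumour (`∞` if there is
no such time). -/
noncomputable def spreadTime (P : Protocol) (v : V) (ω : Realization V) : ℝ≥0∞ :=
  ⨅ (t : ℝ≥0) (_ : ∀ y, Informed P ω v y t), (t : ℝ≥0∞)

end Spreading

section SpreadTimes

variable {V : Type*} [Fintype V] [MeasurableSpace V]

/-- The average spread time of `G`: the smallest `t` such that the expected spread time is at most
`t` for every starting vertex. -/
noncomputable def avgSpreadTime (P : Protocol) (G : SimpleGraph V) : ℝ≥0∞ :=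
  sInf {t | ∀ v, ∫⁻ ω, spreadTime P v ω ∂(law G) ≤ t}

/-- The guaranteed spread time of an `n`-vertex graph `G`: the smallest `t` such that the spread
time exceeds `t` with probability at most `1 / n`, for every starting vertex. -/
noncomputable def guaranteedSpreadTime (P : Protocol) (G : SimpleGraph V) : ℝ≥0∞ :=
  sInf {t | ∀ v, law G {ω | t < spreadTime P v ω} ≤ (Fintype.card V : ℝ≥0∞)⁻¹}

end SpreadTimes

/-- The double star on `n` vertices: the centres `0` and `1` are adjacent, and the remaining
vertices are leaves, the even ones attached to `0` and the odd ones to `1`. -/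
def doubleStar (n : ℕ) : SimpleGraph (Fin n) :=
  SimpleGraph.fromRel fun i j =>
    (i.val = 0 ∧ j.val = 1) ∨ (2 ≤ j.val ∧ i.val = j.val % 2)

end Rumour

/-!
The argument rests on a restart property of the spread. Splicing an independent clock to a Poisson
clock at a fixed time `s` gives a Poisson clock (`measurePreserving_splice`), which is proved on
finite boxes by induction on their length, splitting off the first ring and using that the
exponential distribution is memoryless. Hence the set informed at time `s + t` has the law of the
set informed after a further time `t`, from the set informed at time `s`, in an independent
realization (`lintegral_informedSet_add`). This is the only form of the Markov property that is
needed: all estimates are made for a fixed short time step and then iterated.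

* Restarting with only the initial vertex informed shows that the tails of the spread time are
  submultiplicative. On the scale of the guaranteed spread time this gives geometric tails, hence
  the bound on the average. Conversely, the tail at `e` times the average is at most `exp (-5 / 4)`,
  which is below `exp (-1)` and leaves the room to round `log n` down to an integer.
* For the linear upper bound, take as potential the number of uninformed vertices plus the number
  of those without informed neighbours. It is at most `2 (n - 1)` at the start. A frontier vertex
  pulls the rumour at rate `|N(y) ∩ S| / deg y`, and its neighbours that are uninformed and not yet
  on the frontier then join the frontier, so the potential decreases at rate at least `1`
  (`one_le_sum_frontier`).
* For the logarithmic lower bound, a vertex that takes part in no call is uninformed. By thinning,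
  a vertex `u` is isolated up to time `t` with probability `exp (-t * r u)`, where the contact rates
  `r u` have average `2`. By the second moment method some vertex is isolated up to time
  `9 / 40 * log n` with probability at least `9 / 10`: only adjacent pairs with a vertex of degree
  `O(log n)` are strongly correlated, and there are few of them.
* On the star all leaves have rung within time `O(log n)`, and then once more. On the path the
  expected position of the rightmost informed vertex grows at most linearly. On the double star the
  calls between the two centres have total rate at most `8 / n`, so that for a time of order
  `n * log n` there is none with probability larger than `1 / n`.
-/

namespace Rumour

/-! ### The exponential distribution -/

instance isProbabilityMeasure_expMeasure_one : IsProbabilityMeasure (expMeasure 1) :=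
  isProbabilityMeasure_expMeasure one_pos

lemma expMeasure_Iic {t : ℝ} (ht : 0 ≤ t) :
    expMeasure 1 (Set.Iic t) = ENNReal.ofReal (1 - Real.exp (-t)) := by
  have h := cdf_expMeasure_eq one_pos t
  rw [if_pos ht, one_mul, cdf_eq_real] at h
  rw [← h, ofReal_measureReal]

lemma expMeasure_Ioi {t : ℝ} (ht : 0 ≤ t) :
    expMeasure 1 (Set.Ioi t) = ENNReal.ofReal (Real.exp (-t)) := by
  rw [← Set.compl_Iic, prob_compl_eq_one_sub measurableSet_Iic, expMeasure_Iic ht,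
    ← ENNReal.ofReal_one, ← ENNReal.ofReal_sub _ (by simpa using ht)]
  congr 1; ring

lemma expMeasure_Iic_le {t : ℝ} (ht : 0 ≤ t) : expMeasure 1 (Set.Iic t) ≤ ENNReal.ofReal t := by
  rw [expMeasure_Iic ht]
  exact ENNReal.ofReal_le_ofReal (by linarith [Real.add_one_le_exp (-t)])

/-- The exponential distribution is memoryless. -/
lemma expMeasure_restrict_Ioi {s : ℝ} (hs : 0 ≤ s) :
    (expMeasure 1).restrict (Set.Ioi s) =
      ENNReal.ofReal (Real.exp (-s)) • (expMeasure 1).map (s + ·) := by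
  have : IsFiniteMeasure (ENNReal.ofReal (Real.exp (-s)) • (expMeasure 1).map (s + ·)) :=
    Measure.smul_finite _ ENNReal.ofReal_ne_top
  refine Measure.ext_of_Iic _ _ fun a => ?_
  rw [Measure.restrict_apply measurableSet_Iic, Measure.smul_apply,
    Measure.map_apply (by fun_prop) measurableSet_Iic]
  have hpre : (s + ·) ⁻¹' Set.Iic a = Set.Iic (a - s) := by
    ext u; simp [le_sub_iff_add_le, add_comm]
  rw [hpre, smul_eq_mul]
  rcases le_or_gt s a with h | h
  · have hI : Set.Iic a ∩ Set.Ioi s = Set.Iic a \ Set.Iic s := by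
      ext u; simp [and_comm]
    rw [hI, measure_sdiff (Set.Iic_subset_Iic.2 h) measurableSet_Iic.nullMeasurableSet
      (measure_ne_top _ _), expMeasure_Iic (hs.trans h), expMeasure_Iic hs,
      expMeasure_Iic (sub_nonneg.2 h), ← ENNReal.ofReal_sub _ (by simpa using hs),
      ← ENNReal.ofReal_mul (Real.exp_pos _).le]
    congr 1
    rw [mul_sub, ← Real.exp_add, show -s + -(a - s) = -a by ring]
    ring
  · have hI : Set.Iic a ∩ Set.Ioi s = ∅ := by
      ext u; simp only [Set.mem_inter_iff, Set.mem_Iic, Set.mem_Ioi, Set.mem_empty_iff_false,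
        iff_false, not_and, not_lt]; intro hu; linarith
    have h0 : expMeasure 1 (Set.Iic (a - s)) = 0 := by
      refine measure_mono_null (t := Set.Iic 0) (Set.Iic_subset_Iic.2 (by linarith)) ?_
      simp [expMeasure_Iic le_rfl]
    rw [hI, h0]; simp

lemma lintegral_expMeasure (f : ℝ → ℝ≥0∞) (hf : Measurable f) :
    ∫⁻ u, f u ∂(expMeasure 1) = ∫⁻ u in Set.Ici 0, ENNReal.ofReal (Real.exp (-u)) * f u := by
  have h : expMeasure 1 = volume.withDensity (exponentialPDF 1) := rfl
  have hm : Measurable (exponentialPDF 1) := (measurable_exponentialPDFReal 1).ennreal_ofReal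
  rw [h, lintegral_withDensity_eq_lintegral_mul _ hm hf,
    ← lintegral_indicator measurableSet_Ici]
  refine lintegral_congr fun u => ?_
  by_cases hu : 0 ≤ u
  · simp [Set.indicator, hu, exponentialPDF_of_nonneg]
  · simp [Set.indicator, hu, exponentialPDF_of_neg (not_le.1 hu)]

/-- The fixed-point equation of `t ↦ exp (-p t)` for the renewal recursion that describes thinning
a unit rate clock with retention probability `p`. -/
lemma lintegral_exp_renewal {p t : ℝ} (ht : 0 ≤ t) (hp : p ≤ 1) :
    ENNReal.ofReal (1 - p) *
      ∫⁻ u in Set.Iic t, ENNReal.ofReal (Real.exp (-(p * (t - u)))) ∂(expMeasure 1) =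
      ENNReal.ofReal (Real.exp (-(p * t)) - Real.exp (-t)) := by
  rw [← lintegral_indicator measurableSet_Iic,
    lintegral_expMeasure _ (Measurable.indicator (by fun_prop) measurableSet_Iic)]
  have h1 : ∀ u, ENNReal.ofReal (Real.exp (-u)) * (Set.Iic t).indicator
      (fun u => ENNReal.ofReal (Real.exp (-(p * (t - u))))) u = (Set.Iic t).indicator
      (fun u => ENNReal.ofReal (Real.exp (-(p * t)) * Real.exp (-(1 - p) * u))) u := by
    intro u
    by_cases hu : u ≤ t
    · simp only [Set.indicator, Set.mem_Iic, hu, if_true]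
      rw [← ENNReal.ofReal_mul (Real.exp_pos _).le, ← Real.exp_add, ← Real.exp_add]
      ring_nf
    · simp [Set.indicator, hu]
  simp_rw [h1]
  rw [lintegral_indicator measurableSet_Iic, Measure.restrict_restrict measurableSet_Iic,
    Set.inter_comm, Set.Ici_inter_Iic, ← ofReal_integral_eq_lintegral_ofReal,
    integral_Icc_eq_integral_Ioc, ← intervalIntegral.integral_of_le ht,
    ← ENNReal.ofReal_mul (by linarith), intervalIntegral.integral_const_mul]
  · congr 1
    have hd : ∀ x ∈ Set.uIcc 0 t, HasDerivAt (fun u => -Real.exp (-(1 - p) * u))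
        ((1 - p) * Real.exp (-(1 - p) * x)) x := by
      intro x _
      have := ((hasDerivAt_id x).const_mul (-(1 - p))).exp.neg
      convert! this using 1
      simp only [id]; ring
    have hI := intervalIntegral.integral_eq_sub_of_hasDerivAt hd
      (Continuous.intervalIntegrable (by fun_prop) _ _)
    rw [intervalIntegral.integral_const_mul] at hI
    rw [mul_left_comm, hI, mul_zero, Real.exp_zero,
      show -Real.exp (-(1 - p) * t) - -1 = 1 - Real.exp (-(1 - p) * t) by ring, mul_sub,
      ← Real.exp_add]
    ring_nf
  · exact (Continuous.integrableOn_Icc (by fun_prop))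
  · exact ae_of_all _ fun u => by positivity

/-! ### Independent sequences -/

section Seq

variable {α : Type*}

/-- The sequence with head `e` and tail `w`. -/
def consSeq (e : α) (w : ℕ → α) : ℕ → α
  | 0 => e
  | k + 1 => w k

@[simp] lemma consSeq_zero (e : α) (w : ℕ → α) : consSeq e w 0 = e := rfl

@[simp] lemma consSeq_succ (e : α) (w : ℕ → α) (k : ℕ) : consSeq e w (k + 1) = w k := rfl

variable [MeasurableSpace α]

@[fun_prop]
lemma measurable_consSeq : Measurable fun p : α × (ℕ → α) => consSeq p.1 p.2 := by
  refine measurable_pi_iff.2 fun k => ?_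
  cases k <;> simp <;> fun_prop

variable (μ : Measure α) [IsProbabilityMeasure μ]

lemma infinitePi_box (t : ℕ → Set α) (ht : ∀ i, MeasurableSet (t i)) (m : ℕ)
    (hm : ∀ i, m ≤ i → t i = Set.univ) :
    Measure.infinitePi (fun _ : ℕ => μ) {w | ∀ i, w i ∈ t i} = ∏ i ∈ Finset.range m, μ (t i) := by
  rw [← Measure.infinitePi_pi (fun _ : ℕ => μ) (fun i _ => ht i)]
  congr 1
  ext w
  simp only [Set.mem_ofPred_eq, Set.mem_pi, Finset.coe_range, Set.mem_Iio]
  refine ⟨fun h i _ => h i, fun h i => ?_⟩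
  by_cases hi : i < m
  · exact h i hi
  · simp [hm i (not_lt.1 hi)]

lemma eq_infinitePi_of_box (ν : Measure (ℕ → α))
    (h : ∀ (t : ℕ → Set α) (m : ℕ), (∀ i, MeasurableSet (t i)) → (∀ i, m ≤ i → t i = Set.univ) →
      ν {w | ∀ i, w i ∈ t i} = ∏ i ∈ Finset.range m, μ (t i)) :
    ν = Measure.infinitePi (fun _ : ℕ => μ) := by
  classical
  refine Measure.eq_infinitePi _ fun s t ht => ?_
  set t' : ℕ → Set α := fun i => if i ∈ s then t i else Set.univ with ht'
  obtain ⟨m, hm⟩ : ∃ m, ∀ i ∈ s, i < m := ⟨s.sup id + 1, fun i hi =>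
    Nat.lt_succ_of_le (Finset.le_sup (f := id) hi)⟩
  have h1 := h t' m (fun i => by by_cases hi : i ∈ s <;> simp [ht', hi, ht])
    (fun i hi => by
      have : i ∉ s := fun h => absurd (hm i h) (not_lt.2 hi)
      simp [ht', this])
  have h2 : {w : ℕ → α | ∀ i, w i ∈ t' i} = (s : Set ℕ).pi t := by
    ext w
    simp only [Set.mem_ofPred_eq, Set.mem_pi, ht', Finset.mem_coe]
    refine forall_congr' fun i => ?_
    by_cases hi : i ∈ s <;> simp [hi]
  rw [← h2, h1]
  refine (Finset.prod_subset (fun i hi => Finset.mem_range.2 (hm i hi)) fun i _ hi => ?_).symm.trans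
    (Finset.prod_congr rfl fun i hi => ?_)
  · simp [ht', hi]
  · simp [ht', hi]

/-- An independent sequence is an independent pair of a head and a tail. -/
lemma measurePreserving_consSeq :
    MeasurePreserving (fun p : α × (ℕ → α) => consSeq p.1 p.2)
      (μ.prod (Measure.infinitePi fun _ : ℕ => μ)) (Measure.infinitePi fun _ : ℕ => μ) := by
  refine ⟨measurable_consSeq, eq_infinitePi_of_box μ _ fun t m ht hm => ?_⟩
  rw [Measure.map_apply measurable_consSeq
    (by rw [Set.ofPred_forall]; exact MeasurableSet.iInter fun i => measurable_pi_apply i (ht i))]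
  have h1 : (fun p : α × (ℕ → α) => consSeq p.1 p.2) ⁻¹' {w | ∀ i, w i ∈ t i} =
      t 0 ×ˢ {w | ∀ i, w i ∈ t (i + 1)} := by
    ext ⟨e, w⟩
    simp only [Set.mem_preimage, Set.mem_ofPred_eq, Set.mem_prod]
    refine ⟨fun h => ⟨h 0, fun i => h (i + 1)⟩, fun h i => ?_⟩
    cases i with
    | zero => exact h.1
    | succ i => exact h.2 i
  rw [h1, Measure.prod_prod, infinitePi_box μ (fun i => t (i + 1)) (fun i => ht _) m
    (fun i hi => hm _ (by omega)), mul_comm, ← Finset.prod_range_succ' (fun i => μ (t i)) m,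
    Finset.prod_range_succ, hm m le_rfl, measure_univ, mul_one]

lemma infinitePi_eq_lintegral_consSeq {A : Set (ℕ → α)} (hA : MeasurableSet A) :
    Measure.infinitePi (fun _ : ℕ => μ) A =
      ∫⁻ e, Measure.infinitePi (fun _ : ℕ => μ) {w | consSeq e w ∈ A} ∂μ := by
  rw [← (measurePreserving_consSeq μ).measure_preimage hA.nullMeasurableSet,
    Measure.prod_apply (measurable_consSeq hA)]
  rfl

end Seq

/-! ### A single marked Poisson clock -/

section Clock

variable {M : Type*}

/-- The time of the `k`-th ring of a clock with waiting times `(w j).1`. -/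
noncomputable def clockRing (w : ℕ → ℝ × M) (k : ℕ) : ℝ := ∑ j ∈ Finset.range (k + 1), (w j).1

@[simp] lemma clockRing_zero (w : ℕ → ℝ × M) : clockRing w 0 = (w 0).1 := by simp [clockRing]

lemma clockRing_succ (w : ℕ → ℝ × M) (k : ℕ) :
    clockRing w (k + 1) = (w 0).1 + clockRing (fun j => w (j + 1)) k := by
  rw [clockRing, Finset.sum_range_succ', add_comm, clockRing]

lemma clockRing_consSeq_succ (e : ℝ × M) (w : ℕ → ℝ × M) (k : ℕ) :
    clockRing (consSeq e w) (k + 1) = e.1 + clockRing w k := by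
  rw [clockRing_succ]; rfl

lemma clockRing_pos {w : ℕ → ℝ × M} (hw : ∀ j, 0 < (w j).1) (k : ℕ) : 0 < clockRing w k :=
  Finset.sum_pos (fun j _ => hw j) ⟨0, by simp⟩

lemma le_clockRing {w : ℕ → ℝ × M} (hw : ∀ j, 0 < (w j).1) {j k : ℕ} (hj : j ≤ k) :
    (w j).1 ≤ clockRing w k :=
  Finset.single_le_sum (f := fun j => (w j).1) (fun j _ => (hw j).le)
    (Finset.mem_range.2 (Nat.lt_succ_of_le hj))

/-- The clock that follows `w` up to time `s` and restarts as `w'` at time `s`. -/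
noncomputable def splice : ℝ → (ℕ → ℝ × M) → (ℕ → ℝ × M) → ℕ → ℝ × M
  | s, w, w', 0 => if s < (w 0).1 then (s + (w' 0).1, (w' 0).2) else w 0
  | s, w, w', k + 1 =>
    if s < (w 0).1 then w' (k + 1) else splice (s - (w 0).1) (fun j => w (j + 1)) w' k

lemma splice_of_lt {s : ℝ} {w w' : ℕ → ℝ × M} (h : s < (w 0).1) :
    splice s w w' = consSeq (s + (w' 0).1, (w' 0).2) (fun j => w' (j + 1)) := by
  ext1 k; cases k <;> simp [splice, h]

lemma splice_of_le {s : ℝ} {w w' : ℕ → ℝ × M} (h : (w 0).1 ≤ s) :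
    splice s w w' = consSeq (w 0) (splice (s - (w 0).1) (fun j => w (j + 1)) w') := by
  ext1 k; cases k <;> simp [splice, h.not_gt]

lemma clockRing_splice_of_lt {s : ℝ} {w w' : ℕ → ℝ × M} (h : s < (w 0).1) (k : ℕ) :
    clockRing (splice s w w') k = s + clockRing w' k ∧ (splice s w w' k).2 = (w' k).2 := by
  rw [splice_of_lt h]
  cases k with
  | zero => simp
  | succ k => rw [clockRing_consSeq_succ, clockRing_succ w', add_assoc]; simp

/-- The rings of `w` up to time `s` are rings of the spliced clock. -/
lemma clockRing_splice_of_clockRing_le {s : ℝ} {w w' : ℕ → ℝ × M} (hw : ∀ j, 0 < (w j).1) {k : ℕ}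
    (h : clockRing w k ≤ s) :
    clockRing (splice s w w') k = clockRing w k ∧ (splice s w w' k).2 = (w k).2 := by
  induction k generalizing s w with
  | zero => rw [splice_of_le (by simpa using h)]; simp
  | succ k ih =>
    have h0 : (w 0).1 ≤ s := (le_clockRing hw (Nat.zero_le _)).trans h
    rw [clockRing_succ] at h
    have := ih (s := s - (w 0).1) (w := fun j => w (j + 1)) (fun j => hw _) (by linarith)
    rw [splice_of_le h0, clockRing_consSeq_succ, clockRing_succ w, this.1]
    exact ⟨rfl, this.2⟩

/-- The rings of `w'`, delayed by `s`, are rings of the spliced clock. -/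
lemma exists_clockRing_splice_eq_add {s : ℝ} {w w' : ℕ → ℝ × M} (hN : ∃ m, s < clockRing w m)
    (k : ℕ) : ∃ k', clockRing (splice s w w') k' = s + clockRing w' k ∧
      (splice s w w' k').2 = (w' k).2 := by
  obtain ⟨m, hm⟩ := hN
  induction m generalizing s w with
  | zero => exact ⟨k, clockRing_splice_of_lt (by simpa using hm) k⟩
  | succ m ih =>
    by_cases h : s < (w 0).1
    · exact ⟨k, clockRing_splice_of_lt h k⟩
    · rw [clockRing_succ] at hm
      obtain ⟨k', h1, h2⟩ := ih (s := s - (w 0).1) (w := fun j => w (j + 1)) (by linarith)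
      refine ⟨k' + 1, ?_⟩
      rw [splice_of_le (not_lt.1 h), clockRing_consSeq_succ, h1]
      exact ⟨by ring, h2⟩

/-- Each ring of the spliced clock comes from `w` or from `w'`. -/
lemma clockRing_splice_cases (s : ℝ) (w w' : ℕ → ℝ × M) (k : ℕ) :
    (clockRing w k ≤ s ∧ clockRing (splice s w w') k = clockRing w k ∧
      (splice s w w' k).2 = (w k).2) ∨
    ∃ k', clockRing (splice s w w') k = s + clockRing w' k' ∧
      (splice s w w' k).2 = (w' k').2 := by
  induction k generalizing s w with
  | zero =>
    by_cases h : s < (w 0).1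
    · exact .inr ⟨0, clockRing_splice_of_lt h 0⟩
    · refine .inl ?_
      rw [splice_of_le (not_lt.1 h)]
      simpa using h
  | succ k ih =>
    by_cases h : s < (w 0).1
    · exact .inr ⟨k + 1, clockRing_splice_of_lt h _⟩
    · rw [splice_of_le (not_lt.1 h), clockRing_consSeq_succ, consSeq_succ, clockRing_succ w]
      rcases ih (s - (w 0).1) (fun j => w (j + 1)) with ⟨h1, h2, h3⟩ | ⟨k', h2, h3⟩
      · exact .inl ⟨by linarith, by rw [h2], h3⟩
      · exact .inr ⟨k', by rw [h2]; ring, h3⟩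

variable [MeasurableSpace M]

@[fun_prop]
lemma measurable_clockRing (k : ℕ) : Measurable fun w : ℕ → ℝ × M => clockRing w k := by
  unfold clockRing; fun_prop

lemma measurable_splice_apply (k : ℕ) : Measurable fun q : ℝ × (ℕ → ℝ × M) × (ℕ → ℝ × M) =>
    splice q.1 q.2.1 q.2.2 k := by
  have hs : MeasurableSet {q : ℝ × (ℕ → ℝ × M) × (ℕ → ℝ × M) | q.1 < (q.2.1 0).1} :=
    measurableSet_lt (by fun_prop) (by fun_prop)
  induction k with
  | zero =>
    simp only [splice]
    exact Measurable.ite hs (by fun_prop) (by fun_prop)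
  | succ k ih =>
    simp only [splice]
    refine Measurable.ite hs (by fun_prop) ?_
    exact ih.comp (g := fun q : ℝ × (ℕ → ℝ × M) × (ℕ → ℝ × M) => splice q.1 q.2.1 q.2.2 k)
      (f := fun q : ℝ × (ℕ → ℝ × M) × (ℕ → ℝ × M) =>
        (q.1 - (q.2.1 0).1, (fun j => q.2.1 (j + 1)), q.2.2)) (by fun_prop)

@[fun_prop]
lemma measurable_splice (s : ℝ) :
    Measurable fun q : (ℕ → ℝ × M) × (ℕ → ℝ × M) => splice s q.1 q.2 :=
  measurable_pi_iff.2 fun k => (measurable_splice_apply k).comp (by fun_prop :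
    Measurable fun q : (ℕ → ℝ × M) × (ℕ → ℝ × M) => (s, q))

variable (p : Measure M) [IsProbabilityMeasure p]

/-- The law of one waiting time and one mark. -/
noncomputable abbrev stepLaw : Measure (ℝ × M) := (expMeasure 1).prod p

/-- The law of a clock with rate `1` and independent marks with law `p`. -/
noncomputable abbrev clockLaw : Measure (ℕ → ℝ × M) := Measure.infinitePi fun _ => stepLaw p

lemma stepLaw_memoryless {s : ℝ} (hs : 0 ≤ s) {A : Set (ℝ × M)} (hA : MeasurableSet A) :
    stepLaw p {e | s < e.1} * stepLaw p {e | (s + e.1, e.2) ∈ A} =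
      stepLaw p ({e | s < e.1} ∩ A) := by
  have h0 : {e : ℝ × M | s < e.1} = Set.Ioi s ×ˢ Set.univ := by ext; simp
  have h1 : (stepLaw p).restrict {e | s < e.1} =
      ENNReal.ofReal (Real.exp (-s)) • (stepLaw p).map (fun e => (s + e.1, e.2)) := by
    have h2 : (stepLaw p).map (fun e => (s + e.1, e.2)) = ((expMeasure 1).map (s + ·)).prod p := by
      conv_rhs => rw [← Measure.map_id (μ := p)]
      rw [Measure.map_prod_map _ _ (by fun_prop) measurable_id]
      rfl
    rw [h0, ← Measure.prod_restrict, Measure.restrict_univ, expMeasure_restrict_Ioi hs, h2,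
      Measure.prod_smul_left]
  rw [Set.inter_comm, ← Measure.restrict_apply hA, h1, Measure.smul_apply,
    Measure.map_apply (by fun_prop) hA, h0, Measure.prod_prod, expMeasure_Ioi hs, measure_univ,
    mul_one]
  rfl

lemma lintegral_clockLaw {f : (ℕ → ℝ × M) → ℝ≥0∞} (hf : Measurable f) :
    ∫⁻ w, f w ∂clockLaw p = ∫⁻ e, ∫⁻ w, f (consSeq e w) ∂clockLaw p ∂stepLaw p := by
  rw [← (measurePreserving_consSeq (stepLaw p)).lintegral_comp hf]
  exact lintegral_prod _ (hf.comp measurable_consSeq).aemeasurable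

lemma lintegral_splice_box {s : ℝ} (hs : 0 ≤ s) (t : ℕ → Set (ℝ × M))
    (ht : ∀ i, MeasurableSet (t i)) (m : ℕ) (hm : ∀ i, m ≤ i → t i = Set.univ) :
    ∫⁻ w, clockLaw p {w' | ∀ i, splice s w w' i ∈ t i} ∂clockLaw p =
      ∏ i ∈ Finset.range m, stepLaw p (t i) := by
  induction m generalizing s t with
  | zero => simp [hm]
  | succ m ih =>
    set P := ∏ i ∈ Finset.range m, stepLaw p (t (i + 1)) with hP
    have hmeas : Measurable fun w => clockLaw p {w' | ∀ i, splice s w w' i ∈ t i} := by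
      refine measurable_measure_prodMk_left
        (s := {q : (ℕ → ℝ × M) × (ℕ → ℝ × M) | ∀ i, splice s q.1 q.2 i ∈ t i}) ?_
      rw [Set.ofPred_forall]
      exact MeasurableSet.iInter fun i => (measurable_pi_iff.1 (measurable_splice s) i) (ht i)
    have hlt : MeasurableSet {e : ℝ × M | s < e.1} := measurableSet_lt (by fun_prop) (by fun_prop)
    have hsh : MeasurableSet {e : ℝ × M | (s + e.1, e.2) ∈ t 0} :=
      (by fun_prop : Measurable fun e : ℝ × M => (s + e.1, e.2)) (ht 0)
    have hhead : ∀ e, ∫⁻ w, clockLaw p {w' | ∀ i, splice s (consSeq e w) w' i ∈ t i} ∂clockLaw p =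
        {e : ℝ × M | s < e.1}.indicator
          (fun _ => stepLaw p {e | (s + e.1, e.2) ∈ t 0} * P) e +
        ({e : ℝ × M | s < e.1}ᶜ ∩ t 0).indicator (fun _ => P) e := by
      intro e
      by_cases he : s < e.1
      · have h1 : ∀ w, clockLaw p {w' | ∀ i, splice s (consSeq e w) w' i ∈ t i} =
            stepLaw p {e | (s + e.1, e.2) ∈ t 0} * P := by
          intro w
          have h2 : {w' | ∀ i, splice s (consSeq e w) w' i ∈ t i} =
              {w' | ∀ i, w' i ∈ consSeq {e | (s + e.1, e.2) ∈ t 0} (fun j => t (j + 1)) i} := by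
            ext w'
            rw [Set.mem_ofPred_eq, splice_of_lt (by simpa using he)]
            refine forall_congr' fun i => ?_
            cases i <;> simp
          rw [h2, infinitePi_box _ _ _ (m + 1), Finset.prod_range_succ']
          · simp [hP, mul_comm]
          · intro i hi
            cases i with
            | zero => simp at hi
            | succ i => exact hm _ hi
          · intro i
            cases i with
            | zero => exact hsh
            | succ i => exact ht _
        simp [h1, he]
      · have h1 : ∀ w, clockLaw p {w' | ∀ i, splice s (consSeq e w) w' i ∈ t i} =
            (t 0).indicator (fun _ =>
              clockLaw p {w' | ∀ i, splice (s - e.1) w w' i ∈ t (i + 1)}) e := by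
          intro w
          have h2 : {w' | ∀ i, splice s (consSeq e w) w' i ∈ t i} =
              {w' | e ∈ t 0 ∧ ∀ i, splice (s - e.1) w w' i ∈ t (i + 1)} := by
            ext w'
            rw [Set.mem_ofPred_eq, splice_of_le (by simpa using he)]
            refine ⟨fun h => ⟨h 0, fun i => h (i + 1)⟩, fun h i => ?_⟩
            cases i
            · exact h.1
            · exact h.2 _
          rw [h2]
          by_cases h3 : e ∈ t 0 <;> simp [h3]
        simp_rw [h1]
        by_cases h3 : e ∈ t 0
        · simp [h3, he, ih (sub_nonneg.2 (not_lt.1 he)) (fun i => t (i + 1)) (fun i => ht _)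
            (fun i hi => hm _ (Nat.succ_le_succ hi)), hP]
        · simp [h3, he]
    rw [lintegral_clockLaw p hmeas, lintegral_congr hhead,
      lintegral_add_left (measurable_const.indicator hlt), lintegral_indicator_const hlt,
      lintegral_indicator_const (hlt.compl.inter (ht 0)), mul_right_comm, mul_comm _ (stepLaw p _),
      stepLaw_memoryless p hs (ht 0), mul_comm P, ← add_mul, Set.inter_comm, Set.inter_comm _ (t 0),
      ← Set.sdiff_eq, measure_inter_add_sdiff _ hlt, Finset.prod_range_succ', mul_comm]

/-- **Restart of a clock.** A clock that follows one Poisson clock up to time `s` and then an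
independent one is a Poisson clock: this is the memoryless property of the Poisson process. -/
lemma measurePreserving_splice {s : ℝ} (hs : 0 ≤ s) :
    MeasurePreserving (fun q : (ℕ → ℝ × M) × (ℕ → ℝ × M) => splice s q.1 q.2)
      ((clockLaw p).prod (clockLaw p)) (clockLaw p) := by
  refine ⟨measurable_splice s, eq_infinitePi_of_box _ _ fun t m ht hm => ?_⟩
  have hbox : MeasurableSet {w : ℕ → ℝ × M | ∀ i, w i ∈ t i} := by
    rw [Set.ofPred_forall]; exact MeasurableSet.iInter fun i => measurable_pi_apply i (ht i)
  rw [Measure.map_apply (measurable_splice s) hbox, Measure.prod_apply (measurable_splice s hbox)]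
  exact lintegral_splice_box p hs t ht m hm

lemma ae_clockLaw_pos : ∀ᵐ w ∂clockLaw p, ∀ j, 0 < (w j).1 := by
  refine ae_all_iff.2 fun j => ?_
  have h : ∀ᵐ e ∂stepLaw p, 0 < e.1 := by
    rw [ae_iff]
    have : {e : ℝ × M | ¬ 0 < e.1} = Set.Iic 0 ×ˢ Set.univ := by ext; simp
    rw [this, Measure.prod_prod, expMeasure_Iic le_rfl]
    simp
  exact (measurePreserving_eval_infinitePi (fun _ : ℕ => stepLaw p) j).quasiMeasurePreserving.ae h

/-- The rings of a clock are almost surely unbounded. -/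
lemma ae_clockLaw_unbounded : ∀ᵐ w ∂clockLaw p, ∀ s, ∃ m, s < clockRing w m := by
  have key : ∀ s : ℕ, ∀ᵐ w ∂clockLaw p, ∃ m, (s : ℝ) < (w m).1 := by
    intro s
    rw [ae_iff, ← nonpos_iff_eq_zero]
    set r := Real.exp (-(s : ℝ)) with hr
    have hr0 : 0 ≤ 1 - r := by
      have : r ≤ 1 := Real.exp_le_one_iff.2 (by simp)
      linarith
    have hle : ∀ m, clockLaw p {w | ¬ ∃ m, (s : ℝ) < (w m).1} ≤ ENNReal.ofReal (1 - r) ^ m := by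
      intro m
      have h2 : ∏ i ∈ Finset.range m, stepLaw p
          (if i < m then Set.Iic (s : ℝ) ×ˢ Set.univ else Set.univ) = ENNReal.ofReal (1 - r) ^ m := by
        rw [Finset.prod_congr rfl (g := fun _ => ENNReal.ofReal (1 - r)), Finset.prod_const,
          Finset.card_range]
        intro i hi
        rw [if_pos (Finset.mem_range.1 hi), Measure.prod_prod, measure_univ, mul_one,
          expMeasure_Iic (Nat.cast_nonneg s)]
      rw [← h2, ← infinitePi_box]
      · refine measure_mono fun w hw i => ?_
        simp only [Set.mem_ofPred_eq, not_exists, not_lt] at hw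
        by_cases hi : i < m <;> simp [hi, hw]
      · intro i
        by_cases hi : i < m
        · simpa only [hi, if_true] using measurableSet_Iic.prod MeasurableSet.univ
        · simp [hi]
      · intro i hi; simp [not_lt.2 hi]
    refine ge_of_tendsto' (ENNReal.tendsto_pow_atTop_nhds_zero_of_lt_one ?_) hle
    rw [← ENNReal.ofReal_one]
    exact (ENNReal.ofReal_lt_ofReal_iff one_pos).2 (by linarith [Real.exp_pos (-(s : ℝ))])
  filter_upwards [ae_all_iff.2 key, ae_clockLaw_pos p] with w hw hpos s
  obtain ⟨n, hn⟩ := exists_nat_ge s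
  obtain ⟨m, hm⟩ := hw n
  exact ⟨m, (hn.trans_lt hm).trans_le (le_clockRing hpos le_rfl)⟩

end Clock

/-! ### Thinning of a clock -/

section Thinning

variable {M : Type*}

/-- The event that none of the first `k` rings of the clock up to time `t` has its mark in `B`. -/
def avoids (B : Set M) (k : ℕ) (t : ℝ) : Set (ℕ → ℝ × M) :=
  {w | ∀ j < k, clockRing w j ≤ t → (w j).2 ∉ B}

lemma consSeq_mem_avoids (B : Set M) (k : ℕ) (t : ℝ) (e : ℝ × M) (w : ℕ → ℝ × M) :
    consSeq e w ∈ avoids B (k + 1) t ↔ (e.1 ≤ t → e.2 ∉ B) ∧ w ∈ avoids B k (t - e.1) := by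
  have h : ∀ j, clockRing w j ≤ t - e.1 ↔ clockRing (consSeq e w) (j + 1) ≤ t := fun j => by
    rw [clockRing_consSeq_succ, le_sub_iff_add_le']
  simp only [avoids, Set.mem_ofPred_eq, h]
  refine ⟨fun H => ⟨by simpa using H 0 (Nat.succ_pos _), fun j hj => H (j + 1) (by omega)⟩,
    fun H j hj => ?_⟩
  cases j with
  | zero => simpa using H.1
  | succ j => exact H.2 j (by omega)

variable [MeasurableSpace M] {B : Set M}

lemma measurableSet_avoids_prod (hB : MeasurableSet B) (k : ℕ) :
    MeasurableSet {q : ℝ × (ℕ → ℝ × M) | q.2 ∈ avoids B k q.1} := by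
  have h : {q : ℝ × (ℕ → ℝ × M) | q.2 ∈ avoids B k q.1} =
      ⋂ j : ℕ, ⋂ _ : j < k, {q | clockRing q.2 j ≤ q.1 → (q.2 j).2 ∉ B} := by
    ext; simp [avoids]
  rw [h]
  refine MeasurableSet.iInter fun j => MeasurableSet.iInter fun _ => MeasurableSet.imp ?_ ?_
  · exact measurableSet_le (by fun_prop) measurable_fst
  · exact ((by fun_prop : Measurable fun q : ℝ × (ℕ → ℝ × M) => (q.2 j).2) hB).compl

lemma measurableSet_avoids (hB : MeasurableSet B) (k : ℕ) (t : ℝ) :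
    MeasurableSet (avoids B k t) :=
  (measurable_prodMk_left (x := t)) (measurableSet_avoids_prod hB k)

variable (p : Measure M) [IsProbabilityMeasure p]

lemma clockLaw_avoids_of_neg (k : ℕ) {t : ℝ} (ht : t < 0) : clockLaw p (avoids B k t) = 1 := by
  rw [← measure_univ (μ := clockLaw p)]
  refine measure_congr ?_
  filter_upwards [ae_clockLaw_pos p] with w hw
  refine eq_true fun j _ h => absurd (clockRing_pos hw j) (by linarith)

/-- Renewal recursion for the probability of avoiding the mark set `B`. -/
lemma clockLaw_avoids_succ (hB : MeasurableSet B) (k : ℕ) {t : ℝ} (ht : 0 ≤ t) :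
    clockLaw p (avoids B (k + 1) t) = ENNReal.ofReal (Real.exp (-t)) +
      ENNReal.ofReal (1 - p.real B) *
        ∫⁻ u in Set.Iic t, clockLaw p (avoids B k (t - u)) ∂(expMeasure 1) := by
  have hg : Measurable fun u : ℝ => clockLaw p (avoids B k (t - u)) :=
    (measurable_measure_prodMk_left (measurableSet_avoids_prod hB k)).comp
      (by fun_prop : Measurable fun u : ℝ => t - u)
  have hhead : ∀ e : ℝ × M, clockLaw p {w | consSeq e w ∈ avoids B (k + 1) t} =
      (Set.Ioi t ×ˢ (Set.univ : Set M)).indicator 1 e +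
      (Set.Iic t).indicator (fun u => clockLaw p (avoids B k (t - u))) e.1 *
        Bᶜ.indicator 1 e.2 := by
    intro e
    simp only [consSeq_mem_avoids]
    by_cases he : e.1 ≤ t
    · by_cases hb : e.2 ∈ B <;> simp [he, hb]
    · have := clockLaw_avoids_of_neg p (B := B) k (t := t - e.1) (by linarith)
      simpa [he, not_le.1 he] using this
  have hc : p Bᶜ = ENNReal.ofReal (1 - p.real B) := by
    rw [← ofReal_measureReal, probReal_compl_eq_one_sub hB]
  rw [infinitePi_eq_lintegral_consSeq _ (measurableSet_avoids hB _ _), lintegral_congr hhead,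
    lintegral_add_left (measurable_one.indicator (measurableSet_Ioi.prod .univ)),
    lintegral_indicator_one (measurableSet_Ioi.prod .univ), Measure.prod_prod, measure_univ,
    mul_one, expMeasure_Ioi ht,
    lintegral_prod_mul (hg.indicator measurableSet_Iic).aemeasurable
      (measurable_one.indicator hB.compl).aemeasurable,
    lintegral_indicator measurableSet_Iic, lintegral_indicator_one hB.compl, hc, mul_comm]

lemma clockLaw_avoids_bounds (hB : MeasurableSet B) (k : ℕ) {t : ℝ} (ht : 0 ≤ t) :
    ENNReal.ofReal (Real.exp (-(p.real B * t))) ≤ clockLaw p (avoids B k t) ∧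
      clockLaw p (avoids B k t) ≤
        ENNReal.ofReal (Real.exp (-(p.real B * t))) + ENNReal.ofReal (1 - p.real B) ^ k := by
  have hq : p.real B ≤ 1 := measureReal_le_one
  have hq0 : 0 ≤ p.real B := measureReal_nonneg
  have hfix : ∀ {s}, 0 ≤ s → ENNReal.ofReal (Real.exp (-(p.real B * s))) =
      ENNReal.ofReal (Real.exp (-s)) + ENNReal.ofReal (1 - p.real B) * ∫⁻ u in Set.Iic s,
        ENNReal.ofReal (Real.exp (-(p.real B * (s - u)))) ∂(expMeasure 1) := by
    intro s hs
    rw [lintegral_exp_renewal hs hq, ← ENNReal.ofReal_add (Real.exp_pos _).le]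
    · congr 1; ring
    · rw [sub_nonneg, Real.exp_le_exp]; nlinarith
  induction k generalizing t with
  | zero =>
    have : avoids B 0 t = Set.univ := by ext; simp [avoids]
    rw [this, measure_univ, pow_zero]
    refine ⟨?_, le_add_self⟩
    rw [ENNReal.ofReal_le_one, Real.exp_le_one_iff]
    nlinarith
  | succ k ih =>
    have hsub : ∀ u, u ∈ Set.Iic t → 0 ≤ t - u := fun u hu => sub_nonneg.2 hu
    rw [clockLaw_avoids_succ p hB k ht, hfix ht]
    constructor
    · refine add_le_add le_rfl (mul_le_mul' le_rfl ?_)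
      exact setLIntegral_mono' measurableSet_Iic fun u hu => (ih (hsub u hu)).1
    · rw [add_assoc]
      gcongr
      rw [pow_succ', ← mul_add]
      gcongr
      calc ∫⁻ u in Set.Iic t, clockLaw p (avoids B k (t - u)) ∂(expMeasure 1)
          ≤ ∫⁻ u in Set.Iic t, (ENNReal.ofReal (Real.exp (-(p.real B * (t - u)))) +
              ENNReal.ofReal (1 - p.real B) ^ k) ∂(expMeasure 1) :=
            setLIntegral_mono' measurableSet_Iic fun u hu =>
              (ih (hsub u hu)).2
        _ ≤ _ := by
            rw [lintegral_add_left (by fun_prop)]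
            gcongr
            rw [setLIntegral_const]
            exact mul_le_of_le_one_right' prob_le_one

/-- **Thinning.** The rings of a unit rate clock with marks in `B` form a Poisson process of rate
`p B`: none of them occurs up to time `t` with probability `exp (-p B * t)`. -/
lemma clockLaw_forall_notMem (hB : MeasurableSet B) {t : ℝ} (ht : 0 ≤ t) :
    clockLaw p {w | ∀ j, clockRing w j ≤ t → (w j).2 ∉ B} =
      ENNReal.ofReal (Real.exp (-(p.real B * t))) := by
  have hq : p.real B ≤ 1 := measureReal_le_one
  have hset : {w : ℕ → ℝ × M | ∀ j, clockRing w j ≤ t → (w j).2 ∉ B} = ⋂ k, avoids B k t := by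
    ext w
    simp only [Set.mem_ofPred_eq, avoids, Set.mem_iInter]
    exact ⟨fun h k j _ => h j, fun h j => h (j + 1) j (Nat.lt_succ_self j)⟩
  have hanti : Antitone fun k => avoids B k t := fun k l hkl w hw j hj => hw j (hj.trans_le hkl)
  have hlim := tendsto_measure_iInter_atTop (μ := clockLaw p)
    (fun k => (measurableSet_avoids hB k t).nullMeasurableSet) hanti ⟨0, measure_ne_top _ _⟩
  rw [hset]
  refine le_antisymm ?_ (ge_of_tendsto' hlim fun k => (clockLaw_avoids_bounds p hB k ht).1)
  rcases eq_or_lt_of_le (measureReal_nonneg (μ := p) (s := B)) with h0 | h0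
  · rw [← h0]; simpa using prob_le_one
  · have hpow : Tendsto (fun k => ENNReal.ofReal (Real.exp (-(p.real B * t))) +
        ENNReal.ofReal (1 - p.real B) ^ k) atTop
        (nhds (ENNReal.ofReal (Real.exp (-(p.real B * t))) + 0)) := by
      refine tendsto_const_nhds.add (ENNReal.tendsto_pow_atTop_nhds_zero_of_lt_one ?_)
      rw [← ENNReal.ofReal_one]
      exact (ENNReal.ofReal_lt_ofReal_iff one_pos).2 (by linarith)
    rw [add_zero] at hpow
    exact le_of_tendsto_of_tendsto' hlim hpow fun k => (clockLaw_avoids_bounds p hB k ht).2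

end Thinning

/-! ### The spread from a set of vertices -/

section Spread

variable {V : Type*}

/-- `InformedFrom P ω A y t`: in the realization `ω` of the protocol `P`, the vertex `y` knows the
rumour at time `t` if exactly the vertices in `A` know it at time `0`. -/
inductive InformedFrom (P : Protocol) (ω : Realization V) (A : Set V) : V → ℝ → Prop
  | source (y : V) (t : ℝ) (hy : y ∈ A) (ht : 0 ≤ t) : InformedFrom P ω A y t
  | push (x : V) (k : ℕ) (s t : ℝ) (hP : P = Protocol.pushPull) (hx : InformedFrom P ω A x s)
      (hs : s < ringTime ω x k) (ht : ringTime ω x k ≤ t) : InformedFrom P ω A (ω (x, k)).2 t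
  | pull (x : V) (k : ℕ) (s t : ℝ) (hy : InformedFrom P ω A (ω (x, k)).2 s)
      (hs : s < ringTime ω x k) (ht : ringTime ω x k ≤ t) : InformedFrom P ω A x t

/-- The set of the vertices that know the rumour at time `t` if exactly the vertices in `A` know it
at time `0`. -/
def informedSet (P : Protocol) (A : Set V) (t : ℝ) (ω : Realization V) : Set V :=
  {y | InformedFrom P ω A y t}

variable {P : Protocol} {A A' : Set V} {ω ω' : Realization V} {v y : V} {s t : ℝ}

lemma mem_informedSet : y ∈ informedSet P A t ω ↔ InformedFrom P ω A y t := Iff.rfl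

lemma informed_iff_mem_informedSet : Informed P ω v y t ↔ y ∈ informedSet P {v} t ω := by
  constructor
  · intro h
    induction h with
    | source t ht => exact .source _ _ rfl ht
    | push x k s t hP _ hs ht ih => exact .push x k s t hP ih hs ht
    | pull x k s t _ hs ht ih => exact .pull x k s t ih hs ht
  · intro h
    induction h with
    | source y t hy ht => cases hy; exact .source t ht
    | push x k s t hP _ hs ht ih => exact .push x k s t hP ih hs ht
    | pull x k s t _ hs ht ih => exact .pull x k s t ih hs ht

lemma InformedFrom.mono (h : InformedFrom P ω A y s) (hst : s ≤ t) : InformedFrom P ω A y t := by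
  cases h with
  | source y _ hy ht => exact .source _ _ hy (ht.trans hst)
  | push x k r _ hP hx hs ht => exact .push x k r t hP hx hs (ht.trans hst)
  | pull x k r _ hx hs ht => exact .pull y k r t hx hs (ht.trans hst)

lemma informedSet_mono (hst : s ≤ t) : informedSet P A s ω ⊆ informedSet P A t ω :=
  fun _ h => InformedFrom.mono h hst

lemma informedSet_mono_left (hA : A ⊆ A') : informedSet P A t ω ⊆ informedSet P A' t ω := by
  intro y h
  rw [mem_informedSet] at h
  induction h with
  | source y t hy ht => exact .source _ _ (hA hy) ht
  | push x k s t hP _ hs ht ih => exact .push x k s t hP ih hs ht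
  | pull x k s t _ hs ht ih => exact .pull x k s t ih hs ht

lemma subset_informedSet (ht : 0 ≤ t) : A ⊆ informedSet P A t ω := fun _ hy => .source _ _ hy ht

lemma informedSet_zero (hω : ∀ p, 0 < (ω p).1) : informedSet P A 0 ω = A := by
  refine Set.Subset.antisymm (fun y h => ?_) (subset_informedSet le_rfl)
  have hpos : ∀ x k, 0 < ringTime ω x k := fun x k => clockRing_pos (fun j => hω (x, j)) k
  cases h with
  | source y t hy ht => exact hy
  | push x k s t hP hx hs ht => exact absurd (hpos x k) (not_lt.2 ht)
  | pull x k s t hx hs ht => exact absurd (hpos _ k) (not_lt.2 ht)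

/-- A set that no call up to time `t` leaves or enters keeps the rumour inside. -/
lemma informedSet_subset_of_forall_call {B : Set V} (hAB : A ⊆ B)
    (h : ∀ x k, ringTime ω x k ≤ t → (x ∈ B ↔ (ω (x, k)).2 ∈ B)) :
    informedSet P A t ω ⊆ B := by
  intro y hy
  rw [mem_informedSet] at hy
  induction hy with
  | source y t hy ht => exact hAB hy
  | push x k s t hP _ hs ht ih =>
    exact (h x k ht).1 (ih fun x k hk => h x k (hk.trans (hs.le.trans ht)))
  | pull x k s t _ hs ht ih =>
    exact (h x k ht).2 (ih fun x k hk => h x k (hk.trans (hs.le.trans ht)))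

/-- The realization that follows `ω` up to time `s` and restarts as `ω'` at time `s`. -/
noncomputable def spliceRealization (s : ℝ) (ω ω' : Realization V) : Realization V :=
  fun p => splice s (fun k => ω (p.1, k)) (fun k => ω' (p.1, k)) p.2

/-- **Restart of the spread.** The set informed at time `s + t` is the set informed after a further
time `t` from the set informed at time `s`. -/
lemma informedSet_spliceRealization (hω : ∀ p, 0 < (ω p).1)
    (hN : ∀ x s, ∃ m, s < ringTime ω x m) (hω' : ∀ p, 0 < (ω' p).1) (hs : 0 ≤ s) (ht : 0 ≤ t) :
    informedSet P A (s + t) (spliceRealization s ω ω') =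
      informedSet P (informedSet P A s ω) t ω' := by
  set c := spliceRealization s ω ω' with hc
  have hpos' : ∀ x k, 0 < ringTime ω' x k := fun x k => clockRing_pos (fun j => hω' (x, j)) k
  have hold : ∀ x k, ringTime ω x k ≤ s →
      ringTime c x k = ringTime ω x k ∧ (c (x, k)).2 = (ω (x, k)).2 := fun x k h =>
    clockRing_splice_of_clockRing_le (w := fun j => ω (x, j)) (w' := fun j => ω' (x, j))
      (fun j => hω (x, j)) h
  have hnew : ∀ x k, ∃ k', ringTime c x k' = s + ringTime ω' x k ∧
      (c (x, k')).2 = (ω' (x, k)).2 := fun x k =>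
    exists_clockRing_splice_eq_add (w := fun j => ω (x, j)) (w' := fun j => ω' (x, j)) (hN x s) k
  have hcases : ∀ x k, (ringTime ω x k ≤ s ∧ ringTime c x k = ringTime ω x k ∧
      (c (x, k)).2 = (ω (x, k)).2) ∨ ∃ k', ringTime c x k = s + ringTime ω' x k' ∧
      (c (x, k)).2 = (ω' (x, k')).2 := fun x k =>
    clockRing_splice_cases s (fun j => ω (x, j)) (fun j => ω' (x, j)) k
  apply Set.Subset.antisymm
  · have key : ∀ {y r}, InformedFrom P c A y r → (r ≤ s → InformedFrom P ω A y r) ∧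
        (s ≤ r → InformedFrom P ω' (informedSet P A s ω) y (r - s)) := by
      intro y r h
      induction h with
      | source y r hy hr =>
        exact ⟨fun _ => .source _ _ hy hr, fun h => .source _ _ (.source _ _ hy hs) (by linarith)⟩
      | push x k r' r hP _ hr' hr ih =>
        rcases hcases x k with ⟨h1, h2, h3⟩ | ⟨k', h2, h3⟩
        · have h4 : InformedFrom P ω A (c (x, k)).2 (ringTime ω x k) := by
            rw [h3]; exact .push x k r' _ hP (ih.1 (by linarith)) (by linarith) le_rfl
          exact ⟨fun _ => h4.mono (by linarith),
            fun h => .source _ _ (h4.mono (by linarith)) (by linarith)⟩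
        · have := hpos' x k'
          refine ⟨fun h => by linarith, fun _ => ?_⟩
          rw [h3]
          rcases le_total s r' with h5 | h5
          · exact .push x k' (r' - s) _ hP (ih.2 h5) (by linarith) (by linarith)
          · exact .push x k' 0 _ hP (.source _ _ ((ih.1 h5).mono h5) le_rfl) this (by linarith)
      | pull x k r' r _ hr' hr ih =>
        rcases hcases x k with ⟨h1, h2, h3⟩ | ⟨k', h2, h3⟩
        · have h4 : InformedFrom P ω A x (ringTime ω x k) := by
            rw [h3] at ih
            exact .pull x k r' _ (ih.1 (by linarith)) (by linarith) le_rfl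
          exact ⟨fun _ => h4.mono (by linarith),
            fun h => .source _ _ (h4.mono (by linarith)) (by linarith)⟩
        · have := hpos' x k'
          rw [h3] at ih
          refine ⟨fun h => by linarith, fun _ => ?_⟩
          rcases le_total s r' with h5 | h5
          · exact .pull x k' (r' - s) _ (ih.2 h5) (by linarith) (by linarith)
          · exact .pull x k' 0 _ (.source _ _ ((ih.1 h5).mono h5) le_rfl) this (by linarith)
    intro y hy
    simpa [mem_informedSet] using (key hy).2 (by linarith)
  · have key1 : ∀ {y r}, InformedFrom P ω A y r → r ≤ s → InformedFrom P c A y r := by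
      intro y r h
      induction h with
      | source y r hy hr => exact fun _ => .source _ _ hy hr
      | push x k r' r hP _ hr' hr ih =>
        intro h
        obtain ⟨h1, h2⟩ := hold x k (hr.trans h)
        rw [← h2]
        exact .push x k r' r hP (ih (by linarith)) (by linarith) (by linarith)
      | pull x k r' r _ hr' hr ih =>
        intro h
        obtain ⟨h1, h2⟩ := hold x k (hr.trans h)
        rw [← h2] at ih
        exact .pull x k r' r (ih (by linarith)) (by linarith) (by linarith)
    have key2 : ∀ {y r}, InformedFrom P ω' (informedSet P A s ω) y r →
        InformedFrom P c A y (s + r) := by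
      intro y r h
      induction h with
      | source y r hy hr => exact (key1 hy le_rfl).mono (by linarith)
      | push x k r' r hP _ hr' hr ih =>
        obtain ⟨k', h1, h2⟩ := hnew x k
        rw [← h2]
        exact .push x k' _ _ hP ih (by linarith) (by linarith)
      | pull x k r' r _ hr' hr ih =>
        obtain ⟨k', h1, h2⟩ := hnew x k
        rw [← h2] at ih
        exact .pull x k' _ _ ih (by linarith) (by linarith)
    exact fun y hy => key2 hy

/-! ### Measurability of the informed set -/

/-- The event that `y` learns the rumour by time `t` through a chain of at most `n` calls, described
by countable operations. -/
def reachSet (P : Protocol) (A : Set V) : ℕ → V → ℝ → Set (Realization V)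
  | 0, y, t => {_ω | y ∈ A ∧ 0 ≤ t}
  | n + 1, y, t => reachSet P A n y t ∪
      ((⋃ (x : V) (k : ℕ) (q : ℚ), {_ω | P = .pushPull} ∩ {ω | (ω (x, k)).2 = y} ∩
        reachSet P A n x q ∩ {ω | q < ringTime ω x k} ∩ {ω | ringTime ω x k ≤ t}) ∪
      ⋃ (z : V) (k : ℕ) (q : ℚ), {ω | (ω (y, k)).2 = z} ∩
        reachSet P A n z q ∩ {ω | q < ringTime ω y k} ∩ {ω | ringTime ω y k ≤ t})

lemma informedFrom_of_mem_reachSet {n : ℕ} (h : ω ∈ reachSet P A n y t) :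
    InformedFrom P ω A y t := by
  induction n generalizing y t with
  | zero => exact .source _ _ h.1 h.2
  | succ n ih =>
    rcases h with h | h | h
    · exact ih h
    · simp only [Set.mem_iUnion] at h
      obtain ⟨x, k, q, ⟨⟨⟨h1, rfl⟩, h3⟩, h4⟩, h5⟩ := h
      exact .push x k q t h1 (ih h3) h4 h5
    · simp only [Set.mem_iUnion] at h
      obtain ⟨z, k, q, ⟨⟨rfl, h3⟩, h4⟩, h5⟩ := h
      exact .pull y k q t (ih h3) h4 h5

lemma reachSet_mono {n : ℕ} (hst : s ≤ t) (h : ω ∈ reachSet P A n y s) :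
    ω ∈ reachSet P A n y t := by
  induction n with
  | zero => exact ⟨h.1, h.2.trans hst⟩
  | succ n ih =>
    rcases h with h | h | h
    · exact .inl (ih h)
    · refine .inr (.inl ?_)
      simp only [Set.mem_iUnion] at h ⊢
      obtain ⟨x, k, q, h, h5⟩ := h
      exact ⟨x, k, q, h, h5.trans hst⟩
    · refine .inr (.inr ?_)
      simp only [Set.mem_iUnion] at h ⊢
      obtain ⟨z, k, q, h, h5⟩ := h
      exact ⟨z, k, q, h, h5.trans hst⟩

lemma exists_mem_reachSet (h : InformedFrom P ω A y t) : ∃ n, ω ∈ reachSet P A n y t := by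
  induction h with
  | source y t hy ht => exact ⟨0, hy, ht⟩
  | push x k s t hP _ hs ht ih =>
    obtain ⟨n, hn⟩ := ih
    obtain ⟨q, hq1, hq2⟩ := exists_rat_btwn hs
    refine ⟨n + 1, .inr (.inl ?_)⟩
    simp only [Set.mem_iUnion]
    exact ⟨x, k, q, ⟨⟨⟨hP, rfl⟩, reachSet_mono hq1.le hn⟩, hq2⟩, ht⟩
  | pull x k s t _ hs ht ih =>
    obtain ⟨n, hn⟩ := ih
    obtain ⟨q, hq1, hq2⟩ := exists_rat_btwn hs
    refine ⟨n + 1, .inr (.inr ?_)⟩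
    simp only [Set.mem_iUnion]
    exact ⟨_, k, q, ⟨⟨rfl, reachSet_mono hq1.le hn⟩, hq2⟩, ht⟩

@[fun_prop]
lemma measurable_ringTime [MeasurableSpace V] (x : V) (k : ℕ) :
    Measurable fun ω : Realization V => ringTime ω x k := by
  unfold ringTime; fun_prop

variable [Fintype V] [MeasurableSpace V] [MeasurableSingletonClass V]

lemma measurableSet_reachSet (n : ℕ) (y : V) (t : ℝ) : MeasurableSet (reachSet P A n y t) := by
  have hcall : ∀ (x : V) (k : ℕ) (z : V), MeasurableSet {ω : Realization V | (ω (x, k)).2 = z} :=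
    fun x k z => (by fun_prop : Measurable fun ω : Realization V => (ω (x, k)).2)
      (measurableSet_singleton z)
  induction n generalizing y t with
  | zero => exact .const _
  | succ n ih =>
    refine (ih y t).union (.union ?_ ?_)
    · refine .iUnion fun x => .iUnion fun k => .iUnion fun q => ?_
      exact ((((MeasurableSet.const _).inter (hcall _ _ _)).inter (ih _ _)).inter
        (measurableSet_lt (by fun_prop) (by fun_prop))).inter
        (measurableSet_le (by fun_prop) (by fun_prop))
    · refine .iUnion fun x => .iUnion fun k => .iUnion fun q => ?_
      exact (((hcall _ _ _).inter (ih _ _)).inter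
        (measurableSet_lt (by fun_prop) (by fun_prop))).inter
        (measurableSet_le (by fun_prop) (by fun_prop))

lemma measurableSet_mem_informedSet (P : Protocol) (A : Set V) (y : V) (t : ℝ) :
    MeasurableSet {ω : Realization V | y ∈ informedSet P A t ω} := by
  have h : {ω : Realization V | y ∈ informedSet P A t ω} = ⋃ n, reachSet P A n y t := by
    ext ω
    simp only [Set.mem_ofPred_eq, Set.mem_iUnion]
    exact ⟨exists_mem_reachSet, fun ⟨n, hn⟩ => informedFrom_of_mem_reachSet hn⟩
  rw [h]
  exact .iUnion fun n => measurableSet_reachSet n y t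

@[fun_prop]
lemma measurable_informedSet (P : Protocol) (A : Set V) (t : ℝ) :
    Measurable (informedSet P A t : Realization V → Set V) :=
  measurable_set_iff.2 fun y => measurableSet_setOfPred.1 (measurableSet_mem_informedSet P A y t)

end Spread

/-! ### The law of the realizations -/

section Law

variable {V : Type*} [Fintype V] [MeasurableSpace V] (G : SimpleGraph V)

/-- The law of a realization is the product of the laws of the clocks of the vertices. -/
lemma measurePreserving_curry_law :
    MeasurePreserving (MeasurableEquiv.curry V ℕ (ℝ × V)) (law G)
      (Measure.pi fun x => clockLaw (callPMF G x).toMeasure) := by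
  refine ⟨MeasurableEquiv.measurable _, ?_⟩
  rw [← Measure.infinitePi_eq_pi]
  exact Measure.infinitePi_map_curry (fun (x : V) (_ : ℕ) => stepLaw (callPMF G x).toMeasure)

lemma measurePreserving_clock (x : V) :
    MeasurePreserving (fun (ω : Realization V) k => ω (x, k)) (law G)
      (clockLaw (callPMF G x).toMeasure) :=
  (measurePreserving_eval (fun x => clockLaw (callPMF G x).toMeasure) x).comp
    (measurePreserving_curry_law G)

/-- Events that each concern a single clock are independent. -/
lemma law_forall_clock (A : V → Set (ℕ → ℝ × V)) :
    law G {ω | ∀ x, (fun k => ω (x, k)) ∈ A x} =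
      ∏ x, clockLaw (callPMF G x).toMeasure (A x) := by
  rw [← Measure.pi_pi, ← (measurePreserving_curry_law G).measure_preimage_equiv]
  congr 1
  ext ω
  simp only [Set.mem_preimage, Set.mem_pi, Set.mem_univ, true_imp_iff]
  rfl

lemma measurePreserving_spliceRealization {s : ℝ} (hs : 0 ≤ s) :
    MeasurePreserving (fun q : Realization V × Realization V => spliceRealization s q.1 q.2)
      ((law G).prod (law G)) (law G) := by
  let ν : V → Measure (ℕ → ℝ × V) := fun x => clockLaw (callPMF G x).toMeasure
  have h1 := (measurePreserving_curry_law G).prod (measurePreserving_curry_law G)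
  have h2 := (measurePreserving_arrowProdEquivProdArrow _ _ V ν ν).symm
  have h3 := measurePreserving_pi (fun x => (ν x).prod (ν x)) ν
    (fun x => measurePreserving_splice (callPMF G x).toMeasure hs)
  have h4 := (measurePreserving_curry_law G).symm
  exact h4.comp (h3.comp (h2.comp h1))

lemma ae_law_pos : ∀ᵐ ω ∂law G, ∀ p, 0 < (ω p).1 := by
  have h : ∀ x : V, ∀ᵐ ω ∂law G, ∀ k, 0 < (ω (x, k)).1 := fun x =>
    (measurePreserving_clock G x).quasiMeasurePreserving.ae (ae_clockLaw_pos _)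
  filter_upwards [ae_all_iff.2 h] with ω hω p using hω p.1 p.2

lemma ae_law_unbounded : ∀ᵐ ω ∂law G, ∀ x s, ∃ m, s < ringTime ω x m :=
  ae_all_iff.2 fun x =>
    (measurePreserving_clock G x).quasiMeasurePreserving.ae (ae_clockLaw_unbounded _)

variable [MeasurableSingletonClass V]

lemma ae_law_call : ∀ᵐ ω ∂law G, ∀ x k, (ω (x, k)).2 ∈ (callPMF G x).support := by
  refine ae_all_iff.2 fun x => ae_all_iff.2 fun k => ?_
  have h : ∀ᵐ e ∂stepLaw (callPMF G x).toMeasure, e.2 ∈ (callPMF G x).support := by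
    rw [ae_iff]
    have : {e : ℝ × V | e.2 ∉ (callPMF G x).support} =
        Set.univ ×ˢ ((callPMF G x).support)ᶜ := by ext; simp
    rw [this, Measure.prod_prod, (PMF.toMeasure_apply_eq_zero_iff _ .of_discrete).2
      disjoint_compl_right, mul_zero]
  exact (measurePreserving_eval_infinitePi (fun p : V × ℕ => stepLaw (callPMF G p.1).toMeasure)
    (x, k)).quasiMeasurePreserving.ae h

/-- **Markov property of the spread.** -/
lemma lintegral_informedSet_add (P : Protocol) (A : Set V) (F : Set V → ℝ≥0∞) {s t : ℝ}
    (hs : 0 ≤ s) (ht : 0 ≤ t) :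
    ∫⁻ ω, F (informedSet P A (s + t) ω) ∂law G =
      ∫⁻ ω, ∫⁻ ω', F (informedSet P (informedSet P A s ω) t ω') ∂law G ∂law G := by
  have hF : Measurable F := .of_discrete
  have hmeas : Measurable fun q : Realization V × Realization V =>
      informedSet P (informedSet P A s q.1) t q.2 := by
    have h1 : Measurable fun q : Set V × Realization V => informedSet P q.1 t q.2 :=
      measurable_from_prod_countable_right fun B => measurable_informedSet P B t
    exact h1.comp (by fun_prop : Measurable fun q : Realization V × Realization V =>
      (informedSet P A s q.1, q.2))
  have hsplice := (measurePreserving_spliceRealization G hs).lintegral_comp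
    (f := fun ω => F (informedSet P A (s + t) ω)) (hF.comp (measurable_informedSet P A (s + t)))
  rw [← hsplice,
    ← lintegral_prod (fun q : Realization V × Realization V =>
      F (informedSet P (informedSet P A s q.1) t q.2)) (hF.comp hmeas).aemeasurable]
  refine lintegral_congr_ae ?_
  have h1 := (Measure.quasiMeasurePreserving_fst (μ := law G) (ν := law G)).ae
    ((ae_law_pos G).and (ae_law_unbounded G))
  have h2 := (Measure.quasiMeasurePreserving_snd (μ := law G) (ν := law G)).ae (ae_law_pos G)
  filter_upwards [h1, h2] with q hq1 hq2
  rw [informedSet_spliceRealization hq1.1 hq1.2 hq2 hs ht]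

end Law

/-! ### Tails of the spread time -/

section SpreadTime

variable {V : Type*} {P : Protocol} {A : Set V} {ω : Realization V} {v : V} {s t : ℝ}

lemma spreadTime_eq (P : Protocol) (v : V) (ω : Realization V) :
    spreadTime P v ω = ⨅ (t : ℝ≥0) (_ : informedSet P {v} t ω = Set.univ), (t : ℝ≥0∞) := by
  simp only [spreadTime, informed_iff_mem_informedSet, Set.eq_univ_iff_forall]

lemma spreadTime_le (ht : 0 ≤ t) (h : informedSet P {v} t ω = Set.univ) :
    spreadTime P v ω ≤ ENNReal.ofReal t := by
  rw [spreadTime_eq]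
  exact iInf₂_le (⟨t, ht⟩ : ℝ≥0) h |>.trans_eq (ENNReal.ofReal_eq_coe_nnreal ht).symm

lemma le_spreadTime (h : informedSet P {v} t ω ≠ Set.univ) :
    ENNReal.ofReal t ≤ spreadTime P v ω := by
  rw [spreadTime_eq]
  refine le_iInf₂ fun r hr => ?_
  rw [← ENNReal.ofReal_coe_nnreal]
  refine ENNReal.ofReal_le_ofReal ?_
  by_contra! hlt
  exact h (Set.univ_subset_iff.1 (hr ▸ informedSet_mono hlt.le))

/-- The event that some vertex does not know the rumour at time `t`. -/
def lateEvent (P : Protocol) (A : Set V) (t : ℝ) : Set (Realization V) :=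
  {ω | informedSet P A t ω ≠ Set.univ}

lemma lateEvent_anti (hst : s ≤ t) : lateEvent P A t ⊆ lateEvent P A s := fun _ h hs =>
  h (Set.univ_subset_iff.1 (hs ▸ informedSet_mono hst))

variable [Fintype V] [MeasurableSpace V] (G : SimpleGraph V)

lemma law_lt_spreadTime_le (ht : 0 ≤ t) (P : Protocol) (v : V) :
    law G {ω | ENNReal.ofReal t < spreadTime P v ω} ≤ law G (lateEvent P {v} t) :=
  measure_mono fun _ h hu => absurd (spreadTime_le ht hu) (not_le.2 h)

lemma law_lateEvent_le (P : Protocol) (v : V) {a : ℝ≥0∞} (h : a < ENNReal.ofReal t) :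
    law G (lateEvent P {v} t) ≤ law G {ω | a < spreadTime P v ω} :=
  measure_mono fun _ hω => h.trans_le (le_spreadTime hω)

lemma lintegral_le_avgSpreadTime (P : Protocol) (v : V) :
    ∫⁻ ω, spreadTime P v ω ∂law G ≤ avgSpreadTime P G :=
  le_sInf fun _ ht => ht v

lemma avgSpreadTime_le {P : Protocol} {b : ℝ≥0∞}
    (h : ∀ v, ∫⁻ ω, spreadTime P v ω ∂law G ≤ b) : avgSpreadTime P G ≤ b :=
  sInf_le h

lemma guaranteedSpreadTime_le {P : Protocol} (ht : 0 ≤ t)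
    (h : ∀ v, law G (lateEvent P {v} t) ≤ (Fintype.card V : ℝ≥0∞)⁻¹) :
    guaranteedSpreadTime P G ≤ ENNReal.ofReal t :=
  sInf_le fun v => (law_lt_spreadTime_le G ht P v).trans (h v)

lemma le_guaranteedSpreadTime {P : Protocol} (v : V)
    (h : (Fintype.card V : ℝ≥0∞)⁻¹ < law G (lateEvent P {v} t)) :
    ENNReal.ofReal t ≤ guaranteedSpreadTime P G := by
  refine le_sInf fun a ha => ?_
  by_contra! hlt
  exact absurd (ha v) (not_le.2 (h.trans_le (law_lateEvent_le G P v hlt)))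

variable [MeasurableSingletonClass V]

lemma measurableSet_lateEvent (P : Protocol) (A : Set V) (t : ℝ) :
    MeasurableSet (lateEvent P A t) :=
  measurable_informedSet P A t (MeasurableSet.of_discrete (s := {B | B ≠ Set.univ}))

lemma law_lateEvent_eq_lintegral (P : Protocol) (A : Set V) (t : ℝ) :
    law G (lateEvent P A t) =
      ∫⁻ ω, ({Set.univ}ᶜ : Set (Set V)).indicator 1 (informedSet P A t ω) ∂law G := by
  rw [← lintegral_indicator_one (measurableSet_lateEvent P A t)]
  rfl

lemma ofReal_mul_law_lateEvent_le (P : Protocol) (v : V) (t : ℝ) :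
    ENNReal.ofReal t * law G (lateEvent P {v} t) ≤ ∫⁻ ω, spreadTime P v ω ∂law G := by
  rw [← lintegral_indicator_const (measurableSet_lateEvent P {v} t)]
  exact lintegral_mono fun ω => Set.indicator_le (fun ω hω => le_spreadTime hω) ω

/-- Submultiplicativity of the tails: if some vertex does not know the rumour at time `s`, the
spread restarts with `v` as one of possibly several informed vertices. -/
lemma law_lateEvent_add_le (P : Protocol) (v : V) (hs : 0 ≤ s) (ht : 0 ≤ t) :
    law G (lateEvent P {v} (s + t)) ≤
      law G (lateEvent P {v} s) * law G (lateEvent P {v} t) := by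
  rw [law_lateEvent_eq_lintegral, lintegral_informedSet_add G P {v} _ hs ht,
    ← lintegral_indicator_one (measurableSet_lateEvent P {v} s),
    ← lintegral_mul_const _ (measurable_one.indicator (measurableSet_lateEvent P {v} s))]
  refine lintegral_mono fun ω => ?_
  rw [← law_lateEvent_eq_lintegral]
  by_cases h : informedSet P {v} s ω = Set.univ
  · have h0 : lateEvent P (informedSet P {v} s ω) t = ∅ := by
      refine Set.eq_empty_of_forall_notMem fun ω' h' => h' ?_
      rw [h]
      exact Set.univ_subset_iff.1 (subset_informedSet ht)
    simp [h0]
  · have h1 : ω ∈ lateEvent P {v} s := h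
    simp only [h1, Set.indicator_of_mem, Pi.one_apply, one_mul]
    exact measure_mono fun ω' h' hu => h' (Set.univ_subset_iff.1
      (hu ▸ informedSet_mono_left (subset_informedSet hs)))

lemma law_lateEvent_nat_mul_le (P : Protocol) (v : V) (ht : 0 ≤ t) (k : ℕ) :
    law G (lateEvent P {v} (k * t)) ≤ law G (lateEvent P {v} t) ^ k := by
  induction k with
  | zero => simpa using prob_le_one
  | succ k ih =>
    rw [pow_succ, Nat.cast_succ, add_mul, one_mul]
    exact (law_lateEvent_add_le G P v (by positivity) ht).trans (by gcongr)

/-- The spread time is at most `t` times the number of multiples of `t` at which some vertex does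
not know the rumour. -/
lemma lintegral_spreadTime_le_tsum (P : Protocol) (v : V) (ht : 0 < t) :
    ∫⁻ ω, spreadTime P v ω ∂law G ≤
      ENNReal.ofReal t * ∑' j : ℕ, law G (lateEvent P {v} (j * t)) := by
  have hmeas : ∀ j : ℕ, Measurable
      ((lateEvent P {v} (j * t)).indicator (1 : Realization V → ℝ≥0∞)) :=
    fun j => measurable_one.indicator (measurableSet_lateEvent P {v} _)
  simp_rw [← fun j : ℕ => lintegral_indicator_one (μ := law G)
    (measurableSet_lateEvent P {v} (j * t))]
  rw [← lintegral_tsum fun j => (hmeas j).aemeasurable,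
    ← lintegral_const_mul _ (Measurable.tsum hmeas)]
  refine lintegral_mono fun ω => ?_
  by_cases h : ∃ j : ℕ, ω ∉ lateEvent P {v} (j * t)
  · classical
    set j := Nat.find h with hj
    have h1 : spreadTime P v ω ≤ ENNReal.ofReal (j * t) :=
      spreadTime_le (by positivity) (not_not.1 (Nat.find_spec h))
    refine h1.trans ?_
    rw [mul_comm, ENNReal.ofReal_mul ht.le]
    gcongr
    refine le_trans ?_ (ENNReal.sum_le_tsum (Finset.range j))
    rw [Finset.sum_congr rfl (g := fun _ => 1), Finset.sum_const, Finset.card_range]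
    · simp
    · intro i hi
      have := Nat.find_min h (Finset.mem_range.1 hi)
      rw [not_not] at this
      simp [this]
  · push Not at h
    have : ∑' j : ℕ, (lateEvent P {v} (j * t)).indicator (1 : Realization V → ℝ≥0∞) ω = ∞ := by
      simp [h]
    rw [this, ENNReal.mul_top (by simpa using ht)]
    exact le_top

/-- Repeated restarts give geometric tails, with ratio `1 / n`, to the spread time on the scale of
the guaranteed spread time. -/
lemma avgSpreadTime_le_guaranteedSpreadTime (P : Protocol) :
    ENNReal.ofReal (1 - 1 / (Fintype.card V : ℝ)) * avgSpreadTime P G ≤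
      guaranteedSpreadTime P G := by
  rcases Nat.eq_zero_or_pos (Fintype.card V) with h0 | h0
  · have : IsEmpty V := Fintype.card_eq_zero_iff.1 h0
    have h : avgSpreadTime P G ≤ 0 := avgSpreadTime_le G fun v => isEmptyElim v
    simp [nonpos_iff_eq_zero.1 h]
  have hc : ENNReal.ofReal (1 - 1 / (Fintype.card V : ℝ)) = 1 - (Fintype.card V : ℝ≥0∞)⁻¹ := by
    rw [ENNReal.ofReal_sub _ (by positivity), ENNReal.ofReal_one, one_div,
      ENNReal.ofReal_inv_of_pos (by exact_mod_cast h0), ENNReal.ofReal_natCast]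
  rw [hc]
  -- Passing to a slightly larger time `r` makes up for the difference between `lateEvent` at time
  -- `t` and the event that the spread time exceeds `t`.
  refine le_sInf fun t ht => le_of_forall_gt fun b hb => ?_
  obtain ⟨r, htr, hrb⟩ := ENNReal.lt_iff_exists_nnreal_btwn.1 hb
  refine lt_of_le_of_lt ?_ hrb
  have hr : 0 < (r : ℝ) := by
    have := (zero_le (a := t)).trans_lt htr
    exact_mod_cast this
  have hlate : ∀ v, law G (lateEvent P {v} r) ≤ (Fintype.card V : ℝ≥0∞)⁻¹ := fun v =>
    (law_lateEvent_le G P v (by simpa using htr)).trans (ht v)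
  have havg : avgSpreadTime P G ≤ r * (1 - (Fintype.card V : ℝ≥0∞)⁻¹)⁻¹ := by
    refine avgSpreadTime_le G fun v => (lintegral_spreadTime_le_tsum G P v hr).trans ?_
    rw [ENNReal.ofReal_coe_nnreal, ← ENNReal.tsum_geometric]
    gcongr with j
    exact (law_lateEvent_nat_mul_le G P v hr.le j).trans (by gcongr; exact hlate v)
  calc (1 - (Fintype.card V : ℝ≥0∞)⁻¹) * avgSpreadTime P G
      ≤ (1 - (Fintype.card V : ℝ≥0∞)⁻¹) * (r * (1 - (Fintype.card V : ℝ≥0∞)⁻¹)⁻¹) := by gcongr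
    _ = r * ((1 - (Fintype.card V : ℝ≥0∞)⁻¹) * (1 - (Fintype.card V : ℝ≥0∞)⁻¹)⁻¹) := by ring
    _ ≤ r * 1 := by gcongr; exact ENNReal.mul_inv_le_one _
    _ = r := mul_one _

/-- At the time `e * a`, where `a` bounds the expected spread time, the tail is at most
`exp (-5 / 4)`. Markov's inequality only gives `exp (-1)`; the improvement comes from the
submultiplicativity of the tails, by which the tail at time `e * a / 2` is at least the square
root of the tail at time `e * a`. -/
lemma law_lateEvent_exp_one_mul_le (P : Protocol) (v : V) {a : ℝ} (ha : 0 < a)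
    (h : ∫⁻ ω, spreadTime P v ω ∂law G ≤ ENNReal.ofReal a) :
    (law G).real (lateEvent P {v} (Real.exp 1 * a)) ≤ Real.exp (-(5 / 4)) := by
  set b := Real.exp 1 * a / 2 with hb
  have hb0 : 0 < b := by positivity
  have hbb : Real.exp 1 * a = b + b := by rw [hb]; ring
  rw [hbb]
  set p := (law G).real (lateEvent P {v} (b + b)) with hp
  set q := (law G).real (lateEvent P {v} b) with hq
  have hpq : p ≤ q * q := by
    rw [hp, hq, measureReal_def, measureReal_def, ← ENNReal.toReal_mul]
    exact ENNReal.toReal_mono (ENNReal.mul_ne_top (measure_ne_top _ _) (measure_ne_top _ _))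
      (law_lateEvent_add_le G P v hb0.le hb0.le)
  have hint : b * q + b * p ≤ a := by
    have h1 : ENNReal.ofReal b * law G (lateEvent P {v} b) +
        ENNReal.ofReal b * law G (lateEvent P {v} (b + b)) ≤ ENNReal.ofReal a := by
      refine le_trans ?_ h
      rw [← lintegral_indicator_const (measurableSet_lateEvent P {v} b),
        ← lintegral_indicator_const (measurableSet_lateEvent P {v} (b + b)),
        ← lintegral_add_left (measurable_const.indicator (measurableSet_lateEvent P {v} b))]
      refine lintegral_mono fun ω => ?_
      by_cases h2 : ω ∈ lateEvent P {v} (b + b)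
      · have h1 : ω ∈ lateEvent P {v} b := lateEvent_anti (by linarith) h2
        have := le_spreadTime h2
        rw [ENNReal.ofReal_add hb0.le hb0.le] at this
        simpa [h1, h2] using this
      · by_cases h1 : ω ∈ lateEvent P {v} b
        · simpa [h1, h2] using le_spreadTime h1
        · simp [h1, h2]
    rw [← ofReal_measureReal, ← ofReal_measureReal, ← ENNReal.ofReal_mul hb0.le,
      ← ENNReal.ofReal_mul hb0.le, ← ENNReal.ofReal_add (by positivity) (by positivity)] at h1
    exact (ENNReal.ofReal_le_ofReal_iff ha.le).1 h1
  by_contra! hlt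
  have hq0 : 0 ≤ q := measureReal_nonneg
  have hq1 : Real.exp (-(5 / 8)) < q := by
    refine lt_of_pow_lt_pow_left₀ 2 hq0 ?_
    rw [← Real.exp_nat_mul]
    calc _ = Real.exp (-(5 / 4)) := by norm_num
      _ < p := hlt
      _ ≤ q ^ 2 := by rw [pow_two]; exact hpq
  have h1 : Real.exp 1 * Real.exp (-(5 / 8)) = Real.exp (3 / 8) := by
    rw [← Real.exp_add]; norm_num
  have h2 : Real.exp 1 * Real.exp (-(5 / 4)) = Real.exp (-(1 / 4)) := by
    rw [← Real.exp_add]; norm_num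
  have h3 := Real.add_one_le_exp (3 / 8 : ℝ)
  have h4 := Real.add_one_le_exp (-(1 / 4) : ℝ)
  have h5 : Real.exp 1 * q + Real.exp 1 * p ≤ 2 := by
    have : a * (Real.exp 1 * q + Real.exp 1 * p) ≤ a * 2 := by rw [hb] at hint; linarith
    exact le_of_mul_le_mul_left this ha
  have h6 := mul_lt_mul_of_pos_left hq1 (Real.exp_pos 1)
  have h7 := mul_lt_mul_of_pos_left hlt (Real.exp_pos 1)
  linarith

lemma guaranteedSpreadTime_le_avgSpreadTime (P : Protocol) (h5 : 5 ≤ Real.log (Fintype.card V))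
    (h0 : avgSpreadTime P G ≠ 0) (htop : avgSpreadTime P G ≠ ∞) :
    guaranteedSpreadTime P G ≤
      ENNReal.ofReal (Real.exp 1 * Real.log (Fintype.card V)) * avgSpreadTime P G := by
  set L := Real.log (Fintype.card V) with hL
  set a := (avgSpreadTime P G).toReal with ha
  have ha0 : 0 < a := ENNReal.toReal_pos h0 htop
  have haE : ENNReal.ofReal a = avgSpreadTime P G := ENNReal.ofReal_toReal htop
  have hn : (0 : ℝ) < Fintype.card V := by
    rcases Nat.eq_zero_or_pos (Fintype.card V) with h | h
    · rw [hL, h] at h5; simp at h5; linarith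
    · exact_mod_cast h
  rw [← haE, ← ENNReal.ofReal_mul (by positivity)]
  refine guaranteedSpreadTime_le G (by positivity) fun v => ?_
  have hp := law_lateEvent_exp_one_mul_le G P v ha0 (haE ▸ lintegral_le_avgSpreadTime G P v)
  -- The loss from rounding down is absorbed, since `5 / 4 * (L - 1) ≥ L` for `L ≥ 5`.
  set k := ⌊L⌋₊ with hk
  have hkL : (k : ℝ) ≤ L := Nat.floor_le (by linarith)
  have hLk : L < k + 1 := Nat.lt_floor_add_one L
  calc law G (lateEvent P {v} (Real.exp 1 * L * a))
      ≤ law G (lateEvent P {v} (k * (Real.exp 1 * a))) := by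
        refine measure_mono (lateEvent_anti ?_)
        calc (k : ℝ) * (Real.exp 1 * a) ≤ L * (Real.exp 1 * a) := by gcongr
          _ = _ := by ring
    _ ≤ law G (lateEvent P {v} (Real.exp 1 * a)) ^ k :=
        law_lateEvent_nat_mul_le G P v (by positivity) k
    _ ≤ ENNReal.ofReal (Real.exp (-(5 / 4))) ^ k := by
        gcongr
        rw [← ofReal_measureReal]
        exact ENNReal.ofReal_le_ofReal hp
    _ = ENNReal.ofReal (Real.exp (k * -(5 / 4))) := by
        rw [← ENNReal.ofReal_pow (Real.exp_pos _).le, Real.exp_nat_mul]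
    _ ≤ ENNReal.ofReal (Real.exp (-L)) := by
        refine ENNReal.ofReal_le_ofReal (Real.exp_le_exp.2 ?_)
        linarith
    _ = (Fintype.card V : ℝ≥0∞)⁻¹ := by
        rw [Real.exp_neg, hL, Real.exp_log hn, ENNReal.ofReal_inv_of_pos hn, ENNReal.ofReal_natCast]

end SpreadTime

/-! ### Neighbours and calls -/

section Calls

variable {V : Type*} [Fintype V] (G : SimpleGraph V)

open Classical in
/-- The neighbours of `x` in the set `B`. -/
noncomputable def nbrs (x : V) (B : Set V) : Finset V :=
  Finset.univ.filter fun y => G.Adj x y ∧ y ∈ B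

@[simp] lemma mem_nbrs {x y : V} {B : Set V} : y ∈ nbrs G x B ↔ G.Adj x y ∧ y ∈ B := by
  simp [nbrs]

/-- The number of neighbours of `x`. -/
noncomputable def deg (x : V) : ℕ := (nbrs G x Set.univ).card

lemma deg_pos {x y : V} (h : G.Adj x y) : 0 < deg G x :=
  Finset.card_pos.2 ⟨y, by simpa using h⟩

lemma deg_pos_of_connected {G : SimpleGraph V} (hG : G.Connected)
    (hV : 1 < Fintype.card V) (x : V) : 0 < deg G x := by
  have := Fintype.one_lt_card_iff_nontrivial.1 hV
  obtain ⟨y, hy⟩ := hG.preconnected.exists_adj_of_nontrivial x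
  exact deg_pos G hy

lemma nonempty_filter_adj {x : V} (hx : 0 < deg G x) [DecidablePred (G.Adj x)] :
    (Finset.univ.filter (G.Adj x)).Nonempty := by
  obtain ⟨y, hy⟩ := Finset.card_pos.1 hx
  exact ⟨y, by simpa using hy⟩

lemma adj_of_mem_support_callPMF {x y : V} (hx : 0 < deg G x) (h : y ∈ (callPMF G x).support) :
    G.Adj x y := by
  classical
  unfold callPMF at h
  rw [dif_pos (nonempty_filter_adj G hx), PMF.mem_support_uniformOfFinset_iff] at h
  simpa using h

variable [MeasurableSpace V]

lemma lintegral_law_le {f : Realization V → ℝ≥0∞} {c : ℝ≥0∞} (h : ∀ᵐ ω ∂law G, f ω ≤ c) :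
    ∫⁻ ω, f ω ∂law G ≤ c :=
  (lintegral_mono_ae h).trans_eq (by rw [lintegral_const, measure_univ, mul_one])

lemma clockLaw_first {M : Type*} [MeasurableSpace M] {p : Measure M} [IsProbabilityMeasure p]
    {T : Set (ℝ × M)} (hT : MeasurableSet T) : clockLaw p {w | w 0 ∈ T} = stepLaw p T :=
  (measurePreserving_eval_infinitePi (fun _ : ℕ => stepLaw p) 0).measure_preimage
    hT.nullMeasurableSet

variable [MeasurableSingletonClass V]

lemma callPMF_real {x : V} (hx : 0 < deg G x) (B : Set V) :
    (callPMF G x).toMeasure.real B = (nbrs G x B).card / deg G x := by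
  classical
  have hnb : nbrs G x Set.univ = Finset.univ.filter (G.Adj x) := by ext; simp
  have hf : Finset.filter (fun y => y ∈ B) (Finset.univ.filter (G.Adj x)) = nbrs G x B := by
    ext; simp
  unfold callPMF
  rw [dif_pos (nonempty_filter_adj G hx), measureReal_def,
    PMF.toMeasure_uniformOfFinset_apply _ _ .of_discrete,
    ENNReal.toReal_div, ENNReal.toReal_natCast, ENNReal.toReal_natCast, deg, hnb, ← hf]

end Calls

/-! ### The linear upper bound on the average spread time -/

section Potential

variable {V : Type*} [Fintype V] (G : SimpleGraph V)

open Classical in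
/-- The uninformed vertices with an informed neighbour, if `S` is the set of informed vertices. -/
noncomputable def frontier (S : Set V) : Finset V :=
  Finset.univ.filter fun y => y ∉ S ∧ ∃ x ∈ S, G.Adj x y

open Classical in
/-- The uninformed vertices without informed neighbours, if `S` is the set of informed vertices. -/
noncomputable def remote (S : Set V) : Finset V :=
  Finset.univ.filter fun y => y ∉ S ∧ ∀ x ∈ S, ¬ G.Adj x y

open Classical in
/-- The uninformed vertices, if `S` is the set of informed vertices. -/
noncomputable def uninformed (S : Set V) : Finset V := Finset.univ.filter fun y => y ∉ S

/-- The potential of the set `S` of informed vertices: the number of uninformed vertices plus the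
number of those without informed neighbours. -/
noncomputable def potential (S : Set V) : ℕ :=
  (uninformed S).card + (remote G S).card

@[simp] lemma mem_uninformed {S : Set V} {y : V} : y ∈ uninformed S ↔ y ∉ S := by
  simp [uninformed]

@[simp] lemma mem_frontier {S : Set V} {y : V} :
    y ∈ frontier G S ↔ y ∉ S ∧ ∃ x ∈ S, G.Adj x y := by simp [frontier]

@[simp] lemma mem_remote {S : Set V} {y : V} :
    y ∈ remote G S ↔ y ∉ S ∧ ∀ x ∈ S, ¬ G.Adj x y := by simp [remote]

lemma potential_anti {S T : Set V} (h : S ⊆ T) : potential G T ≤ potential G S := by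
  refine add_le_add (Finset.card_le_card fun y hy => ?_) (Finset.card_le_card fun y hy => ?_)
  · rw [mem_uninformed] at hy ⊢
    exact fun hS => hy (h hS)
  · rw [mem_remote] at hy ⊢
    exact ⟨fun hS => hy.1 (h hS), fun x hx => hy.2 x (h hx)⟩

lemma potential_insert {S : Set V} {y : V} (hy : y ∈ frontier G S) :
    potential G (insert y S) + (1 + (nbrs G y (remote G S)).card) ≤ potential G S := by
  classical
  rw [mem_frontier] at hy
  have h1 : (uninformed (insert y S)).card + 1 ≤ (uninformed S).card := by
    rw [← Finset.card_insert_of_notMem (a := y) (by simp)]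
    refine Finset.card_le_card fun z hz => ?_
    simp only [Finset.mem_insert, mem_uninformed, Set.mem_insert_iff, not_or] at hz ⊢
    rcases hz with rfl | hz
    · exact hy.1
    · exact hz.2
  have h2 : (remote G (insert y S)).card + (nbrs G y (remote G S)).card ≤ (remote G S).card := by
    rw [← Finset.card_union_of_disjoint]
    · refine Finset.card_le_card fun z hz => ?_
      rw [Finset.mem_union, mem_remote, mem_nbrs] at hz
      rcases hz with hz | hz
      · rw [mem_remote]
        exact ⟨fun h => hz.1 (.inr h), fun x hx => hz.2 x (.inr hx)⟩
      · simpa using hz.2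
    · rw [Finset.disjoint_left]
      intro z hz hz'
      rw [mem_remote] at hz
      rw [mem_nbrs] at hz'
      exact hz.2 y (.inl rfl) hz'.1
  unfold potential
  omega

lemma potential_singleton_le (v : V) : potential G {v} ≤ 2 * (Fintype.card V - 1) := by
  classical
  have h : (uninformed ({v} : Set V)).card = Fintype.card V - 1 := by
    rw [← Finset.card_univ, ← Finset.card_erase_of_mem (Finset.mem_univ v)]
    congr 1; ext; simp
  have h2 : (remote G {v}).card ≤ (uninformed ({v} : Set V)).card := by
    refine Finset.card_le_card fun z hz => ?_
    rw [mem_remote] at hz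
    simpa using hz.1
  unfold potential
  omega

variable {G}

lemma frontier_nonempty (hG : G.Connected) {S : Set V} (hS : S.Nonempty) (hS' : S ≠ Set.univ) :
    (frontier G S).Nonempty := by
  obtain ⟨x, hx⟩ := hS
  obtain ⟨y, hy⟩ := (Set.ne_univ_iff_exists_notMem S).1 hS'
  obtain ⟨w⟩ := hG.preconnected x y
  obtain ⟨d, _, h1, h2⟩ := w.exists_boundary_dart S hx hy
  exact ⟨d.snd, by rw [mem_frontier]; exact ⟨h2, d.fst, h1, d.adj⟩⟩

/-- The rate at which the potential decreases is at least `1`: a frontier vertex `y` pulls the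
rumour at rate `|N(y) ∩ S| / deg y`, and then the potential drops by `1` plus the number of remote
neighbours of `y`. -/
lemma one_le_sum_frontier (hG : G.Connected) {S : Set V} (hS : S.Nonempty) (hS' : S ≠ Set.univ) :
    (1 : ℝ) ≤ ∑ y ∈ frontier G S,
      (nbrs G y S).card / deg G y * (1 + (nbrs G y (remote G S)).card : ℝ) := by
  classical
  set m := (frontier G S).card with hm
  have hm0 : 0 < m := Finset.card_pos.2 (frontier_nonempty hG hS hS')
  have hterm : ∀ y ∈ frontier G S,
      (1 / m : ℝ) ≤ (nbrs G y S).card / deg G y * (1 + (nbrs G y (remote G S)).card : ℝ) := by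
    intro y hy
    obtain ⟨hyS, x, hxS, hxy⟩ := (mem_frontier G).1 hy
    set a := (nbrs G y S).card with ha
    set ρ := (nbrs G y (remote G S)).card with hρ
    have ha0 : 1 ≤ a := Finset.card_pos.2 ⟨x, by simp [hxy.symm, hxS]⟩
    have hd0 : 0 < deg G y := deg_pos G hxy.symm
    have hd : deg G y + 1 ≤ a + m + ρ := by
      have hsub : nbrs G y Set.univ ⊆
          nbrs G y S ∪ (frontier G S).erase y ∪ nbrs G y (remote G S) := by
        intro z hz
        have hz : G.Adj y z := by simpa using hz
        simp only [Finset.mem_union, mem_nbrs, Finset.mem_erase, mem_frontier, Finset.mem_coe,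
          mem_remote]
        have hne : z ≠ y := hz.ne'
        by_cases h1 : z ∈ S
        · exact .inl (.inl ⟨hz, h1⟩)
        · by_cases h2 : ∃ x ∈ S, G.Adj x z
          · exact .inl (.inr ⟨hne, h1, h2⟩)
          · push Not at h2
            exact .inr ⟨hz, h1, h2⟩
      have h1 := (Finset.card_le_card hsub).trans (Finset.card_union_le _ _)
      have h2 := Finset.card_union_le (nbrs G y S) ((frontier G S).erase y)
      rw [Finset.card_erase_of_mem hy] at h2
      unfold deg
      omega
    have hkey : deg G y ≤ a * (1 + ρ) * m := by
      obtain ⟨a', ha'⟩ := Nat.exists_eq_add_of_le ha0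
      obtain ⟨m', hm'⟩ := Nat.exists_eq_add_of_le hm0
      have : deg G y ≤ 1 + a' + m' + ρ := by omega
      rw [ha', hm']
      nlinarith [Nat.zero_le (a' * m'), Nat.zero_le (a' * ρ), Nat.zero_le (m' * ρ),
        Nat.zero_le (a' * m' * ρ)]
    rw [div_mul_eq_mul_div, div_le_div_iff₀ (by exact_mod_cast hm0) (by exact_mod_cast hd0),
      one_mul]
    exact_mod_cast hkey
  calc (1 : ℝ) = ∑ _y ∈ frontier G S, (1 / m : ℝ) := by
        rw [Finset.sum_const, nsmul_eq_mul, ← hm]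
        field_simp
    _ ≤ _ := Finset.sum_le_sum hterm

/-- The event that the clock of `y` rings up to time `δ`, its first call goes to `S`, and no other
clock rings up to time `δ`. -/
def soleCall {V : Type*} (δ : ℝ) (y : V) (S : Set V) : Set (Realization V) :=
  {ω | (ω (y, 0)).1 ≤ δ ∧ (ω (y, 0)).2 ∈ S ∧ ∀ x, x ≠ y → δ < (ω (x, 0)).1}

lemma insert_subset_informedSet {V : Type*} {P : Protocol} {S : Set V} {ω : Realization V}
    {δ : ℝ} {y : V} (hω : ∀ p, 0 < (ω p).1) (hδ : 0 ≤ δ) (h : ω ∈ soleCall δ y S) :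
    insert y S ⊆ informedSet P S δ ω := by
  refine Set.insert_subset ?_ (subset_informedSet hδ)
  refine .pull y 0 0 δ (.source _ _ h.2.1 le_rfl) ?_ ?_
  · simpa [ringTime] using hω (y, 0)
  · simpa [ringTime] using h.1

variable [MeasurableSpace V] [MeasurableSingletonClass V]

lemma measurableSet_soleCall (δ : ℝ) (y : V) (S : Set V) : MeasurableSet (soleCall δ y S) := by
  have h : soleCall δ y S = {ω | (ω (y, 0)).1 ≤ δ} ∩ ({ω | (ω (y, 0)).2 ∈ S} ∩
      ⋂ x, ⋂ _ : x ≠ y, {ω | δ < (ω (x, 0)).1}) := by ext; simp [soleCall]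
  rw [h]
  refine (measurableSet_le (by fun_prop) (by fun_prop)).inter (.inter ?_ ?_)
  · exact (by fun_prop : Measurable fun ω : Realization V => (ω (y, 0)).2) (.of_discrete (s := S))
  · exact .iInter fun x => .iInter fun _ => measurableSet_lt (by fun_prop) (by fun_prop)

lemma law_soleCall_ge (y : V) (S : Set V) (hy : 0 < deg G y) {δ : ℝ} (hδ : 0 ≤ δ)
    (hδn : Fintype.card V * δ ≤ 1 / 2) :
    ENNReal.ofReal (δ / 2 * ((nbrs G y S).card / deg G y)) ≤ law G (soleCall δ y S) := by
  classical
  have hset : soleCall δ y S = {ω | ∀ x, (fun k => ω (x, k)) ∈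
      (if x = y then {w : ℕ → ℝ × V | w 0 ∈ Set.Iic δ ×ˢ S}
        else {w | w 0 ∈ Set.Ioi δ ×ˢ Set.univ})} := by
    ext ω
    simp only [soleCall, Set.mem_ofPred_eq]
    constructor
    · rintro ⟨h1, h2, h3⟩ x
      by_cases hx : x = y
      · subst hx; simp [h1, h2]
      · simp [hx, h3 x hx]
    · intro h
      have hy := h y
      simp only [if_true] at hy
      refine ⟨hy.1, hy.2, fun x hx => ?_⟩
      have := h x
      simp only [hx, if_false] at this
      exact this.1
  rw [hset, law_forall_clock, ← Finset.mul_prod_erase _ _ (Finset.mem_univ y)]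
  have h1 : ∀ x ∈ Finset.univ.erase y, clockLaw (callPMF G x).toMeasure
      (if x = y then {w : ℕ → ℝ × V | w 0 ∈ Set.Iic δ ×ˢ S}
        else {w | w 0 ∈ Set.Ioi δ ×ˢ Set.univ}) = ENNReal.ofReal (Real.exp (-δ)) := by
    intro x hx
    rw [if_neg (Finset.ne_of_mem_erase hx), clockLaw_first (measurableSet_Ioi.prod .univ),
      Measure.prod_prod, measure_univ, mul_one, expMeasure_Ioi hδ]
  rw [Finset.prod_congr rfl h1, if_pos rfl, clockLaw_first (measurableSet_Iic.prod .of_discrete),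
    Measure.prod_prod, expMeasure_Iic hδ, Finset.prod_const,
    Finset.card_erase_of_mem (Finset.mem_univ y), Finset.card_univ, ← ofReal_measureReal,
    callPMF_real G hy, mul_right_comm, ← ENNReal.ofReal_pow (Real.exp_pos _).le,
    ← ENNReal.ofReal_mul (by simpa using hδ),
    ← ENNReal.ofReal_mul (mul_nonneg (by simpa using hδ) (by positivity))]
  refine ENNReal.ofReal_le_ofReal ?_
  gcongr
  have hn : 1 ≤ Fintype.card V := Fintype.card_pos_iff.2 ⟨y⟩
  have h2 : δ * Real.exp (-δ) ≤ 1 - Real.exp (-δ) := by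
    have h3 : (δ + 1) * Real.exp (-δ) ≤ Real.exp δ * Real.exp (-δ) := by
      gcongr; exact Real.add_one_le_exp δ
    rw [← Real.exp_add, add_neg_cancel, Real.exp_zero] at h3
    linarith
  calc δ / 2 ≤ δ * Real.exp (-(Fintype.card V * δ)) := by
        have := Real.add_one_le_exp (-(Fintype.card V * δ))
        nlinarith
    _ = δ * Real.exp (-δ) * Real.exp (-δ) ^ (Fintype.card V - 1) := by
        rw [← Real.exp_nat_mul, mul_assoc, ← Real.exp_add]
        congr 2
        rw [Nat.cast_sub hn]; push_cast; ring
    _ ≤ _ := by gcongr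

/-- In a short time `δ`, the expected potential decreases by at least `δ / 2`: the events
`soleCall δ y S` for different `y` are disjoint. -/
lemma lintegral_potential_add_le (hG : G.Connected) (P : Protocol) {S : Set V} (hS : S.Nonempty)
    (hS' : S ≠ Set.univ) {δ : ℝ} (hδ : 0 ≤ δ) (hδn : Fintype.card V * δ ≤ 1 / 2) :
    ∫⁻ ω, (potential G (informedSet P S δ ω) : ℝ≥0∞) ∂law G + ENNReal.ofReal (δ / 2) ≤
      potential G S := by
  classical
  set ρ : V → ℕ := fun y => 1 + (nbrs G y (remote G S)).card with hρ
  have hpt : ∀ᵐ ω ∂law G, (potential G (informedSet P S δ ω) : ℝ≥0∞) +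
      ∑ y ∈ frontier G S, (soleCall δ y S).indicator (fun _ => (ρ y : ℝ≥0∞)) ω ≤
      potential G S := by
    filter_upwards [ae_law_pos G] with ω hω
    by_cases h : ∃ y ∈ frontier G S, ω ∈ soleCall δ y S
    · obtain ⟨y, hy, hyω⟩ := h
      rw [Finset.sum_eq_single_of_mem y hy, Set.indicator_of_mem hyω]
      · have := (Nat.add_le_add_right (potential_anti G
          (insert_subset_informedSet (P := P) hω hδ hyω)) (ρ y)).trans (potential_insert G hy)
        exact_mod_cast this
      · intro z _ hz
        refine Set.indicator_of_notMem (fun hzω => ?_) _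
        exact absurd hyω.1 (not_le.2 (hzω.2.2 y hz.symm))
    · push Not at h
      rw [Finset.sum_eq_zero fun y hy => Set.indicator_of_notMem (h y hy) _, add_zero]
      exact_mod_cast potential_anti G (subset_informedSet hδ)
  have hpot : Measurable fun ω : Realization V => (potential G (informedSet P S δ ω) : ℝ≥0∞) :=
    (Measurable.of_discrete (f := fun T : Set V => (potential G T : ℝ≥0∞))).comp
      (measurable_informedSet P S δ)
  have hint := lintegral_law_le G hpt
  rw [lintegral_add_left hpot, lintegral_finsetSum _ fun y _ =>
    measurable_const.indicator (measurableSet_soleCall δ y S)] at hint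
  refine le_trans (add_le_add le_rfl ?_) hint
  simp_rw [lintegral_indicator_const (measurableSet_soleCall δ _ S)]
  calc ENNReal.ofReal (δ / 2)
      ≤ ENNReal.ofReal (∑ y ∈ frontier G S, δ / 2 * ((nbrs G y S).card / deg G y) * ρ y) := by
        refine ENNReal.ofReal_le_ofReal ?_
        have := one_le_sum_frontier hG hS hS'
        simp_rw [mul_assoc, ← Finset.mul_sum]
        refine le_mul_of_one_le_right (by positivity) (this.trans_eq ?_)
        simp [hρ]
    _ = ∑ y ∈ frontier G S, ρ y * ENNReal.ofReal (δ / 2 * ((nbrs G y S).card / deg G y)) := by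
        rw [ENNReal.ofReal_sum_of_nonneg fun y _ => by positivity]
        refine Finset.sum_congr rfl fun y _ => ?_
        rw [ENNReal.ofReal_mul (by positivity), ENNReal.ofReal_natCast, mul_comm]
    _ ≤ _ := by
        gcongr with y hy
        obtain ⟨_, x, _, hxy⟩ := (mem_frontier G).1 hy
        exact law_soleCall_ge y S (deg_pos G hxy.symm) hδ hδn

/-- The potential of a single informed vertex is at most `2 (n - 1)`, and in each time step `δ` it
decreases by at least `δ / 2` on average until all vertices are informed. -/
lemma avgSpreadTime_le_linear (hG : G.Connected) (P : Protocol) :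
    avgSpreadTime P G ≤ ENNReal.ofReal (4 * (Fintype.card V - 1)) := by
  refine avgSpreadTime_le G fun v => ?_
  have hn : 1 ≤ Fintype.card V := Fintype.card_pos_iff.2 ⟨v⟩
  set δ : ℝ := 1 / (2 * Fintype.card V) with hδdef
  have hδ : 0 < δ := by positivity
  have hδn : Fintype.card V * δ ≤ 1 / 2 := by rw [hδdef]; field_simp; rfl
  set Φ : ℕ → ℝ≥0∞ := fun j =>
    ∫⁻ ω, (potential G (informedSet P {v} (j * δ) ω) : ℝ≥0∞) ∂law G with hΦ
  set q : ℕ → ℝ≥0∞ := fun j => law G (lateEvent P {v} (j * δ)) with hq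
  have hstep : ∀ j, Φ (j + 1) + ENNReal.ofReal (δ / 2) * q j ≤ Φ j := by
    intro j
    simp only [hΦ, hq, Nat.cast_succ, add_mul, one_mul]
    rw [lintegral_informedSet_add G P {v} (fun S => (potential G S : ℝ≥0∞)) (by positivity) hδ.le,
      ← lintegral_indicator_const (measurableSet_lateEvent P {v} (j * δ)),
      ← lintegral_add_right _ (measurable_const.indicator (measurableSet_lateEvent P {v} (j * δ)))]
    refine lintegral_mono fun ω => ?_
    by_cases h : ω ∈ lateEvent P {v} (j * δ)
    · simp only [h, Set.indicator_of_mem]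
      exact lintegral_potential_add_le hG P
        ⟨v, subset_informedSet (by positivity) (Set.mem_singleton v)⟩ h hδ.le hδn
    · simp only [h, not_false_eq_true, Set.indicator_of_notMem, add_zero]
      refine lintegral_law_le G (ae_of_all _ fun ω' => ?_)
      exact_mod_cast potential_anti G (subset_informedSet hδ.le)
  have hsum : ∀ k, Φ k + ENNReal.ofReal (δ / 2) * ∑ j ∈ Finset.range k, q j ≤ potential G {v} := by
    intro k
    induction k with
    | zero =>
      simp only [hΦ, Finset.range_zero, Finset.sum_empty, mul_zero, add_zero]
      refine lintegral_law_le G (ae_of_all _ fun ω' => ?_)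
      exact_mod_cast potential_anti G (subset_informedSet (by simp))
    | succ k ih =>
      refine le_trans ?_ ih
      rw [Finset.sum_range_succ, mul_add, ← add_assoc, add_right_comm]
      gcongr
      exact hstep k
  have htsum : ENNReal.ofReal (δ / 2) * ∑' j, q j ≤ potential G {v} := by
    rw [← ENNReal.tsum_mul_left]
    refine ENNReal.tsum_le_of_sum_range_le fun k => ?_
    rw [← Finset.mul_sum]
    exact le_add_self.trans (hsum k)
  calc ∫⁻ ω, spreadTime P v ω ∂law G ≤ ENNReal.ofReal δ * ∑' j, q j :=
        lintegral_spreadTime_le_tsum G P v hδ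
    _ = 2 * (ENNReal.ofReal (δ / 2) * ∑' j, q j) := by
        rw [← mul_assoc, ← ENNReal.ofReal_ofNat 2, ← ENNReal.ofReal_mul (by positivity),
          mul_div_cancel₀ _ two_ne_zero]
    _ ≤ 2 * ((2 * (Fintype.card V - 1) : ℕ) : ℝ≥0∞) := by
        gcongr
        exact htsum.trans (by exact_mod_cast potential_singleton_le G v)
    _ = ENNReal.ofReal (4 * (Fintype.card V - 1)) := by
        rw [← ENNReal.ofReal_natCast, ← ENNReal.ofReal_ofNat 2, ← ENNReal.ofReal_mul (by positivity)]
        congr 1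
        rw [Nat.cast_mul, Nat.cast_sub hn]; push_cast; ring

end Potential

/-! ### Events without calls and isolated vertices -/

section NoCall

variable {V : Type*}

/-- The event that up to time `t` no vertex `x` calls a vertex in `B x`. -/
def noCall (B : V → Set V) (t : ℝ) : Set (Realization V) :=
  {ω | ∀ x k, ringTime ω x k ≤ t → (ω (x, k)).2 ∉ B x}

open Classical in
/-- The event that `u` takes part in no call up to time `t`. -/
def isolated (u : V) (t : ℝ) : Set (Realization V) :=
  noCall (fun x => if x = u then Set.univ else {u}) t

lemma notMem_informedSet_of_isolated {P : Protocol} {u v : V} {t : ℝ} {ω : Realization V}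
    (huv : u ≠ v) (h : ω ∈ isolated u t) : u ∉ informedSet P {v} t ω := by
  have hsub : informedSet P {v} t ω ⊆ {u}ᶜ := by
    refine informedSet_subset_of_forall_call (by simpa [eq_comm] using huv) fun x k hk => ?_
    have := h x k hk
    by_cases hx : x = u
    · simp [hx] at this
    · simp only [if_neg hx] at this
      exact ⟨fun _ => this, fun _ => hx⟩
  exact fun hu => hsub hu rfl

variable [Fintype V] [MeasurableSpace V] (G : SimpleGraph V)

/-- The rate at which `x` calls `u`. -/
noncomputable def callRate (x u : V) : ℝ := (callPMF G x).toMeasure.real {u}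

lemma callRate_nonneg (x u : V) : 0 ≤ callRate G x u := measureReal_nonneg

/-- The rate of the calls that involve `u`, either as the caller or as the called vertex. -/
noncomputable def contactRate (u : V) : ℝ := 1 + ∑ x, callRate G x u

lemma contactRate_nonneg (u : V) : 0 ≤ contactRate G u :=
  add_nonneg zero_le_one (Finset.sum_nonneg fun x _ => callRate_nonneg G x u)

variable [MeasurableSingletonClass V]

lemma measurableSet_noCall (B : V → Set V) (t : ℝ) : MeasurableSet (noCall B t) := by
  have h : noCall B t = ⋂ x, ⋂ k, {ω | ringTime ω x k ≤ t → (ω (x, k)).2 ∉ B x} := by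
    ext; simp [noCall]
  rw [h]
  refine .iInter fun x => .iInter fun k => MeasurableSet.imp ?_ ?_
  · exact measurableSet_le (by fun_prop) (by fun_prop)
  · exact ((by fun_prop : Measurable fun ω : Realization V => (ω (x, k)).2)
      (.of_discrete (s := B x))).compl

lemma law_noCall (B : V → Set V) {t : ℝ} (ht : 0 ≤ t) :
    law G (noCall B t) =
      ENNReal.ofReal (Real.exp (-(t * ∑ x, (callPMF G x).toMeasure.real (B x)))) := by
  have h := law_forall_clock G fun x => {w | ∀ j, clockRing w j ≤ t → (w j).2 ∉ B x}
  have h1 : noCall B t = {ω | ∀ x, (fun k => ω (x, k)) ∈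
      {w : ℕ → ℝ × V | ∀ j, clockRing w j ≤ t → (w j).2 ∉ B x}} := rfl
  rw [h1, h]
  simp_rw [clockLaw_forall_notMem _ (.of_discrete (s := B _)) ht]
  rw [← ENNReal.ofReal_prod_of_nonneg fun x _ => (Real.exp_pos _).le, ← Real.exp_sum,
    Finset.mul_sum, ← Finset.sum_neg_distrib]
  simp_rw [mul_comm t]

lemma sum_callRate (x : V) : ∑ u, callRate G x u = 1 := by
  unfold callRate
  rw [sum_measureReal_singleton]
  simp

lemma callRate_of_not_adj {x u : V} (hx : 0 < deg G x) (h : ¬ G.Adj x u) :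
    callRate G x u = 0 := by
  rw [callRate, callPMF_real G hx]
  have : nbrs G x {u} = ∅ := by
    ext y
    simp only [mem_nbrs, Set.mem_singleton_iff, Finset.notMem_empty, iff_false, not_and]
    rintro hxy rfl
    exact h hxy
  simp [this]

lemma callRate_le {x : V} (u : V) (hx : 0 < deg G x) : callRate G x u ≤ 1 / deg G x := by
  rw [callRate, callPMF_real G hx]
  have : (nbrs G x {u}).card ≤ 1 := by
    rw [← Finset.card_singleton u]
    refine Finset.card_le_card fun y hy => ?_
    rw [mem_nbrs] at hy
    simpa using hy.2
  gcongr
  exact_mod_cast this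

lemma callPMF_real_pair {u w : V} (h : u ≠ w) (x : V) :
    (callPMF G x).toMeasure.real {u, w} = callRate G x u + callRate G x w := by
  rw [Set.insert_eq, measureReal_union (by simpa using h) (measurableSet_singleton w)]
  rfl

lemma sum_contactRate : ∑ u, contactRate G u = 2 * Fintype.card V := by
  unfold contactRate
  rw [Finset.sum_add_distrib, Finset.sum_comm]
  simp_rw [sum_callRate]
  simp; ring

lemma measurableSet_isolated (u : V) (t : ℝ) : MeasurableSet (isolated u t) :=
  measurableSet_noCall _ t

lemma law_isolated (hG : ∀ x, 0 < deg G x) (u : V) {t : ℝ} (ht : 0 ≤ t) :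
    law G (isolated u t) = ENNReal.ofReal (Real.exp (-(t * contactRate G u))) := by
  classical
  have h : ∑ x, (callPMF G x).toMeasure.real (if x = u then Set.univ else {u}) =
      contactRate G u := by
    have h1 : ∀ x, (callPMF G x).toMeasure.real (if x = u then Set.univ else {u}) =
        (if x = u then 1 else 0) + callRate G x u := by
      intro x
      by_cases hx : x = u
      · subst hx; simp [callRate_of_not_adj G (hG x) (G.loopless.irrefl x)]
      · simp [hx, callRate]
    simp_rw [h1, Finset.sum_add_distrib]
    simp [contactRate]
  rw [← h, ← law_noCall G _ ht]
  unfold isolated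
  congr!

/-- Two vertices are almost independently isolated, up to the calls between them. -/
lemma law_isolated_inter_le (hG : ∀ x, 0 < deg G x) {u w : V} (huw : u ≠ w) {t : ℝ}
    (ht : 0 ≤ t) :
    law G (isolated u t ∩ isolated w t) ≤ ENNReal.ofReal
      (Real.exp (t * (callRate G u w + callRate G w u)) *
        (Real.exp (-(t * contactRate G u)) * Real.exp (-(t * contactRate G w)))) := by
  classical
  have hsub : isolated u t ∩ isolated w t ⊆
      noCall (fun x => if x = u ∨ x = w then Set.univ else {u, w}) t := by
    rintro ω ⟨h1, h2⟩ x k hk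
    have h1 := h1 x k hk
    have h2 := h2 x k hk
    by_cases hu : x = u
    · simp [hu] at h1
    · by_cases hw : x = w
      · simp [hw] at h2
      · simp only [if_neg hu] at h1
        simp only [if_neg hw] at h2
        simp only [if_neg (show ¬ (x = u ∨ x = w) by tauto)]
        rintro (h | h)
        · exact h1 h
        · exact h2 h
  refine (measure_mono hsub).trans ?_
  rw [law_noCall G _ ht, ← Real.exp_add, ← Real.exp_add]
  have h : ∑ x, (callPMF G x).toMeasure.real (if x = u ∨ x = w then Set.univ else {u, w}) =
      contactRate G u + contactRate G w - (callRate G u w + callRate G w u) := by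
    have h1 : ∀ x, (callPMF G x).toMeasure.real (if x = u ∨ x = w then Set.univ else {u, w}) =
        (if x = u then 1 - callRate G u w else 0) + (if x = w then 1 - callRate G w u else 0) +
        (callRate G x u + callRate G x w) := by
      intro x
      have hself := callRate_of_not_adj G (hG x) (G.loopless.irrefl x)
      by_cases hu : x = u
      · subst hu; simp [huw, hself]
      · by_cases hw : x = w
        · subst hw; simp [huw.symm, hself]
        · simp [hu, hw, callPMF_real_pair G huw]
    simp_rw [h1, Finset.sum_add_distrib]
    simp [contactRate]; ring
  rw [h]
  refine ENNReal.ofReal_le_ofReal (Real.exp_le_exp.2 (le_of_eq ?_))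
  ring

/-! ### The logarithmic lower bound -/

lemma two_mul_le_one_add_mul_self (x : ℝ≥0∞) : 2 * x ≤ 1 + x * x := by
  induction x with
  | top => simp
  | coe x =>
    have := two_mul_le_add_sq (1 : ℝ≥0) x
    rw [mul_one, one_pow, pow_two] at this
    exact_mod_cast this

lemma le_sum_exp_contactRate (v : V) {t : ℝ} (ht : 0 ≤ t) [DecidableEq V] :
    Real.exp (-(2 * t)) * (Fintype.card V - 1 - 2 * t) ≤
      ∑ u ∈ Finset.univ.erase v, Real.exp (-(t * contactRate G u)) := by
  have hn : 1 ≤ Fintype.card V := Fintype.card_pos_iff.2 ⟨v⟩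
  -- Convexity of `exp`, with the tangent at the average contact rate `2`.
  have h1 : ∀ u, Real.exp (-(2 * t)) * (1 + 2 * t - t * contactRate G u) ≤
      Real.exp (-(t * contactRate G u)) := by
    intro u
    have h2 : -(t * contactRate G u) = -(2 * t) + (2 * t - t * contactRate G u) := by ring
    rw [h2, Real.exp_add]
    gcongr
    linarith [Real.add_one_le_exp (2 * t - t * contactRate G u)]
  refine le_trans ?_ (Finset.sum_le_sum fun u _ => h1 u)
  rw [← Finset.mul_sum, Finset.sum_sub_distrib, ← Finset.mul_sum, Finset.sum_const,
    Finset.card_erase_of_mem (Finset.mem_univ v), Finset.card_univ, nsmul_eq_mul, Nat.cast_sub hn]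
  refine mul_le_mul_of_nonneg_left ?_ (Real.exp_pos _).le
  have h2 : ∑ u ∈ Finset.univ.erase v, contactRate G u ≤ 2 * Fintype.card V := by
    rw [← sum_contactRate G]
    exact Finset.sum_le_sum_of_subset_of_nonneg (Finset.erase_subset _ _)
      fun u _ _ => contactRate_nonneg G u
  have h3 := mul_le_mul_of_nonneg_left h2 ht
  push_cast
  linarith

/-- The second moment bound for the number of isolated vertices. The diagonal and the adjacent pairs
with a vertex of degree less than `D` are bounded by their number; for the other pairs, the calls
between the two vertices have rate at most `2 / D`. -/
lemma sum_law_isolated_inter_le (hG : ∀ x, 0 < deg G x) (U : Finset V) {t D : ℝ} (ht : 0 ≤ t)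
    (hD : 0 < D) :
    ∑ u ∈ U, ∑ w ∈ U, law G (isolated u t ∩ isolated w t) ≤ ENNReal.ofReal
      (Real.exp (2 * t / D) * (∑ u ∈ U, Real.exp (-(t * contactRate G u))) ^ 2 +
        Fintype.card V * (1 + 2 * D)) := by
  classical
  set p : V → ℝ := fun u => Real.exp (-(t * contactRate G u)) with hp
  set few : V → V → ℝ := fun u w => if G.Adj u w ∧ (deg G u : ℝ) < D then 1 else 0 with hfew
  have hfew0 : ∀ u w, 0 ≤ few u w := fun u w => by simp only [hfew]; split_ifs <;> simp
  have hpair : ∀ u w, law G (isolated u t ∩ isolated w t) ≤ ENNReal.ofReal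
      (Real.exp (2 * t / D) * (p u * p w) + ((if u = w then 1 else 0) + few u w + few w u)) := by
    intro u w
    have hpos : 0 ≤ Real.exp (2 * t / D) * (p u * p w) := by positivity
    by_cases huw : u = w
    · refine prob_le_one.trans ?_
      rw [← ENNReal.ofReal_one]
      refine ENNReal.ofReal_le_ofReal ?_
      rw [if_pos huw]
      linarith [hfew0 u w, hfew0 w u]
    · rw [if_neg huw]
      by_cases hbad : G.Adj u w ∧ ((deg G u : ℝ) < D ∨ (deg G w : ℝ) < D)
      · refine prob_le_one.trans ?_
        rw [← ENNReal.ofReal_one]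
        refine ENNReal.ofReal_le_ofReal ?_
        rcases hbad with ⟨hadj, h | h⟩
        · have : few u w = 1 := if_pos ⟨hadj, h⟩
          linarith [hfew0 w u]
        · have : few w u = 1 := if_pos ⟨hadj.symm, h⟩
          linarith [hfew0 u w]
      · refine (law_isolated_inter_le G hG huw ht).trans (ENNReal.ofReal_le_ofReal ?_)
        have hrate : callRate G u w + callRate G w u ≤ 2 / D := by
          by_cases hadj : G.Adj u w
          · have hbad : D ≤ deg G u ∧ D ≤ deg G w := by
              simpa [hadj, not_or] using hbad
            have h1 := (callRate_le G w (hG u)).trans (one_div_le_one_div_of_le hD hbad.1)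
            have h2 := (callRate_le G u (hG w)).trans (one_div_le_one_div_of_le hD hbad.2)
            have h3 : 2 / D = 1 / D + 1 / D := by ring
            linarith
          · rw [callRate_of_not_adj G (hG u) hadj,
              callRate_of_not_adj G (hG w) fun h => hadj h.symm]
            rw [add_zero]; positivity
        have h1 : Real.exp (t * (callRate G u w + callRate G w u)) ≤ Real.exp (2 * t / D) := by
          rw [Real.exp_le_exp, mul_comm 2 t, mul_div_assoc]
          gcongr
        calc _ ≤ Real.exp (2 * t / D) * (p u * p w) := by gcongr
          _ ≤ _ := by linarith [hfew0 u w, hfew0 w u]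
  have hrow : ∀ u, ∑ w ∈ U, few u w ≤ D := by
    intro u
    by_cases hu : (deg G u : ℝ) < D
    · refine le_trans ?_ hu.le
      simp only [hfew, hu, and_true]
      rw [Finset.sum_ite, Finset.sum_const_zero, add_zero, Finset.sum_const, nsmul_eq_mul, mul_one]
      have : (U.filter fun w => G.Adj u w).card ≤ deg G u :=
        Finset.card_le_card fun w hw => by
          rw [Finset.mem_filter] at hw; simpa using hw.2
      exact_mod_cast this
    · simp [hfew, hu, hD.le]
  have hU : (U.card : ℝ) ≤ Fintype.card V := by exact_mod_cast Finset.card_le_univ U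
  have htotal : ∑ u ∈ U, ∑ w ∈ U, few u w ≤ Fintype.card V * D := by
    refine (Finset.sum_le_sum fun u _ => hrow u).trans ?_
    rw [Finset.sum_const, nsmul_eq_mul]
    gcongr
  have hdiag : ∑ u ∈ U, ∑ w ∈ U, (if u = w then (1 : ℝ) else 0) ≤ Fintype.card V := by
    refine le_trans (le_of_eq ?_) hU
    rw [Finset.card_eq_sum_ones, Nat.cast_sum]
    refine Finset.sum_congr rfl fun u hu => ?_
    simp [hu]
  calc ∑ u ∈ U, ∑ w ∈ U, law G (isolated u t ∩ isolated w t)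
      ≤ ∑ u ∈ U, ∑ w ∈ U, ENNReal.ofReal (Real.exp (2 * t / D) * (p u * p w) +
          ((if u = w then 1 else 0) + few u w + few w u)) :=
        Finset.sum_le_sum fun u _ => Finset.sum_le_sum fun w _ => hpair u w
    _ = ENNReal.ofReal (∑ u ∈ U, ∑ w ∈ U, (Real.exp (2 * t / D) * (p u * p w) +
          ((if u = w then 1 else 0) + few u w + few w u))) := by
        have hnn : ∀ u w, 0 ≤ Real.exp (2 * t / D) * (p u * p w) +
            ((if u = w then 1 else 0) + few u w + few w u) := fun u w =>
          add_nonneg (by positivity) (add_nonneg (add_nonneg (by split_ifs <;> simp) (hfew0 u w))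
            (hfew0 w u))
        rw [ENNReal.ofReal_sum_of_nonneg fun u _ => Finset.sum_nonneg fun w _ => hnn u w]
        exact Finset.sum_congr rfl fun u _ =>
          (ENNReal.ofReal_sum_of_nonneg fun w _ => hnn u w).symm
    _ ≤ _ := by
        refine ENNReal.ofReal_le_ofReal ?_
        simp_rw [Finset.sum_add_distrib, ← Finset.mul_sum, ← Finset.sum_mul]
        rw [Finset.sum_comm (f := fun u w => few w u), pow_two]
        linarith

/-- The second moment method for the number `X` of isolated vertices other than `v`: integrating
`2 * λ * X ≤ 1_{X ≠ 0} + (λ * X) ^ 2` with `λ = 1 / 𝔼 X` bounds the probability that `X ≠ 0` from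
below by `2 - 𝔼 (X ^ 2) / (𝔼 X) ^ 2`. -/
lemma law_lateEvent_ge (hG : ∀ x, 0 < deg G x) (P : Protocol) (v : V) {t D : ℝ} (ht : 0 ≤ t)
    (hD : 0 < D) (hpos : 0 < (Fintype.card V : ℝ) - 1 - 2 * t) :
    2 ≤ law G (lateEvent P {v} t) + ENNReal.ofReal (Real.exp (2 * t / D) +
      Fintype.card V * (1 + 2 * D) /
        (Real.exp (-(2 * t)) * (Fintype.card V - 1 - 2 * t)) ^ 2) := by
  classical
  set U := Finset.univ.erase v with hU
  set m := ∑ u ∈ U, Real.exp (-(t * contactRate G u)) with hm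
  have hm_ge := le_sum_exp_contactRate G v ht
  rw [← hU, ← hm] at hm_ge
  have hm'0 : 0 < Real.exp (-(2 * t)) * (Fintype.card V - 1 - 2 * t) := by positivity
  have hm0 : 0 < m := hm'0.trans_le hm_ge
  set l := ENNReal.ofReal (1 / m) with hl
  have hmeas : ∀ u, Measurable ((isolated u t).indicator (1 : Realization V → ℝ≥0∞)) := fun u =>
    measurable_one.indicator (measurableSet_isolated u t)
  have hmul : ∀ u w, Measurable fun ω : Realization V =>
      (isolated u t).indicator (1 : Realization V → ℝ≥0∞) ω * (isolated w t).indicator 1 ω :=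
    fun u w => (hmeas u).mul (hmeas w)
  set X : Realization V → ℝ≥0∞ := fun ω => ∑ u ∈ U, (isolated u t).indicator 1 ω with hX
  have hXm : Measurable X := Finset.measurable_fun_sum _ fun u _ => hmeas u
  have hXX : Measurable fun ω => X ω * X ω := hXm.mul hXm
  have hpt : ∀ ω, 2 * (l * X ω) ≤ (lateEvent P {v} t).indicator 1 ω + l * l * (X ω * X ω) := by
    intro ω
    by_cases h : ∃ u ∈ U, ω ∈ isolated u t
    · obtain ⟨u, hu, huω⟩ := h
      have hlate : ω ∈ lateEvent P {v} t := fun h => notMem_informedSet_of_isolated (P := P)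
        (Finset.ne_of_mem_erase hu) huω (h ▸ Set.mem_univ u)
      rw [Set.indicator_of_mem hlate, Pi.one_apply, mul_mul_mul_comm]
      exact two_mul_le_one_add_mul_self _
    · push Not at h
      have : X ω = 0 := Finset.sum_eq_zero fun u hu => Set.indicator_of_notMem (h u hu) _
      simp [this]
  have hint := lintegral_mono (μ := law G) hpt
  have h1 : ∫⁻ ω, X ω ∂law G = ENNReal.ofReal m := by
    rw [lintegral_finsetSum _ fun u _ => hmeas u, hm,
      ENNReal.ofReal_sum_of_nonneg fun u _ => (Real.exp_pos _).le]
    refine Finset.sum_congr rfl fun u _ => ?_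
    rw [lintegral_indicator_one (measurableSet_isolated u t), law_isolated G hG u ht]
  have h2 : ∫⁻ ω, X ω * X ω ∂law G = ∑ u ∈ U, ∑ w ∈ U, law G (isolated u t ∩ isolated w t) := by
    simp_rw [hX, Finset.sum_mul_sum]
    rw [lintegral_finsetSum _ fun u _ => Finset.measurable_fun_sum _ fun w _ =>
      hmul u w]
    refine Finset.sum_congr rfl fun u _ => ?_
    rw [lintegral_finsetSum _ fun w _ => hmul u w]
    refine Finset.sum_congr rfl fun w _ => ?_
    rw [← lintegral_indicator_one ((measurableSet_isolated u t).inter (measurableSet_isolated w t)),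
      Set.inter_indicator_one]
    rfl
  rw [lintegral_const_mul _ (hXm.const_mul _), lintegral_const_mul _ hXm, h1, hl,
    ← ENNReal.ofReal_mul (by positivity), one_div_mul_cancel hm0.ne', ENNReal.ofReal_one, mul_one,
    lintegral_add_left (measurable_one.indicator (measurableSet_lateEvent P {v} t)),
    lintegral_indicator_one (measurableSet_lateEvent P {v} t),
    lintegral_const_mul _ hXX, h2] at hint
  refine hint.trans ?_
  gcongr
  calc _ ≤ ENNReal.ofReal (1 / m) * ENNReal.ofReal (1 / m) * ENNReal.ofReal
        (Real.exp (2 * t / D) * m ^ 2 + Fintype.card V * (1 + 2 * D)) := by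
        gcongr
        exact sum_law_isolated_inter_le G hG U ht hD
    _ = ENNReal.ofReal (Real.exp (2 * t / D) + Fintype.card V * (1 + 2 * D) / m ^ 2) := by
        rw [← ENNReal.ofReal_mul (by positivity), ← ENNReal.ofReal_mul (by positivity)]
        congr 1
        field_simp
    _ ≤ _ := by
        refine ENNReal.ofReal_le_ofReal ?_
        gcongr

/-- The parameters `t = 9 / 40 * log n` and `D = 20 * log n` for `law_lateEvent_ge`. As
`9 / 40 < 1 / 4`, the square `n ^ (2 - 9 / 10)` of the mean dominates `n * D`. As
`9 / 40 > 1 / 5`, there is room for the error terms. -/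
lemma eventually_second_moment_ratio_le : ∀ᶠ n : ℕ in atTop,
    0 < (n : ℝ) - 1 - 2 * (9 / 40 * Real.log n) ∧ 0 < Real.log n ∧ 10 / 9 < (n : ℝ) ∧
    Real.exp (2 * (9 / 40 * Real.log n) / (20 * Real.log n)) +
      n * (1 + 2 * (20 * Real.log n)) / (Real.exp (-(2 * (9 / 40 * Real.log n))) *
        (n - 1 - 2 * (9 / 40 * Real.log n))) ^ 2 ≤ 11 / 10 := by
  have hlo := (isLittleO_log_rpow_atTop (r := 1 / 10) (by norm_num)).comp_tendsto
    (tendsto_natCast_atTop_atTop (R := ℝ))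
  have h1 := hlo.bound (c := 1 / 6400) (by norm_num)
  have h2 : ∀ᶠ n : ℕ in atTop, (160 : ℝ) ≤ (n : ℝ) ^ (1 / 10 : ℝ) :=
    ((tendsto_rpow_atTop (by norm_num)).comp tendsto_natCast_atTop_atTop).eventually_ge_atTop 160
  filter_upwards [h1, h2, eventually_ge_atTop 2] with n h1 h2 hn
  have hn' : (2 : ℝ) ≤ n := by exact_mod_cast hn
  have hn0 : (0 : ℝ) < n := by linarith
  set L := Real.log n with hL
  have hL0 : 0 < L := Real.log_pos (by linarith)
  set a := (n : ℝ) ^ (1 / 10 : ℝ) with ha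
  have hLa : 6400 * L ≤ a := by
    simp only [Function.comp_apply, Real.norm_eq_abs, ← hL, ← ha, abs_of_pos hL0] at h1
    rw [abs_of_nonneg (by positivity)] at h1
    linarith
  have han : a ≤ n := by
    rw [ha]
    calc (n : ℝ) ^ (1 / 10 : ℝ) ≤ (n : ℝ) ^ (1 : ℝ) :=
          Real.rpow_le_rpow_of_exponent_le (by linarith) (by norm_num)
      _ = n := Real.rpow_one _
  have hhalf : (n : ℝ) / 2 ≤ n - 1 - 2 * (9 / 40 * L) := by linarith
  refine ⟨by linarith, hL0, by linarith, ?_⟩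
  have hexp1 : Real.exp (2 * (9 / 40 * L) / (20 * L)) ≤ 400 / 391 := by
    have h3 : 2 * (9 / 40 * L) / (20 * L) = -(-(9 / 400)) := by field_simp; norm_num
    have h4 := Real.add_one_le_exp (-(9 / 400) : ℝ)
    rw [h3, Real.exp_neg]
    exact (inv_anti₀ (by norm_num) h4).trans (by norm_num)
  have hexp2 : Real.exp (-(2 * (9 / 40 * L))) ^ 2 = a / n := by
    rw [ha, Real.rpow_def_of_pos hn0, ← hL, ← Real.exp_nat_mul]
    nth_rewrite 1 [← Real.exp_log hn0]
    rw [← hL, ← Real.exp_sub]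
    congr 1
    push_cast; ring
  have hden : a * n / 4 ≤ (Real.exp (-(2 * (9 / 40 * L))) * (n - 1 - 2 * (9 / 40 * L))) ^ 2 := by
    rw [mul_pow, hexp2]
    calc a * n / 4 = a / n * (n / 2) ^ 2 := by field_simp; norm_num
      _ ≤ _ := by gcongr
  have ha0 : 0 < a := by linarith
  have hfrac : n * (1 + 2 * (20 * L)) / (Real.exp (-(2 * (9 / 40 * L))) *
        (n - 1 - 2 * (9 / 40 * L))) ^ 2 ≤ 1 / 20 := by
    calc _ ≤ n * (1 + 2 * (20 * L)) / (a * n / 4) := by gcongr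
      _ = 4 * (1 + 2 * (20 * L)) / a := by field_simp
      _ ≤ 1 / 20 := by
          rw [div_le_iff₀ ha0]
          linarith
  linarith

/-- For large `n`, some vertex is isolated up to time `9 / 40 * log n` with probability at least
`9 / 10`. -/
lemma exists_law_lateEvent_ge : ∃ N : ℕ, ∀ n, N ≤ n → 10 / 9 < (n : ℝ) ∧ 0 < Real.log n ∧
    ∀ (W : Type*) [Fintype W] [MeasurableSpace W] [MeasurableSingletonClass W] (H : SimpleGraph W),
      Fintype.card W = n → (∀ x, 0 < deg H x) → ∀ (P : Protocol) (v : W),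
        ENNReal.ofReal (9 / 10) ≤ law H (lateEvent P {v} (9 / 40 * Real.log n)) := by
  obtain ⟨N, hN⟩ := eventually_atTop.1 eventually_second_moment_ratio_le
  refine ⟨N, fun n hn => ?_⟩
  obtain ⟨h1, hL, h10, h2⟩ := hN n hn
  refine ⟨h10, hL, ?_⟩
  intro W _ _ _ H hW hH P v
  subst hW
  have h3 := law_lateEvent_ge H hH P v (t := 9 / 40 * Real.log (Fintype.card W))
    (D := 20 * Real.log (Fintype.card W)) (by positivity) (by positivity) h1
  have h4 := h3.trans (add_le_add le_rfl (ENNReal.ofReal_le_ofReal h2))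
  have h5 : (2 : ℝ≥0∞) = ENNReal.ofReal (9 / 10) + ENNReal.ofReal (11 / 10) := by
    rw [← ENNReal.ofReal_add (by norm_num) (by norm_num)]; norm_num
  rw [h5] at h4
  exact (ENNReal.add_le_add_iff_right ENNReal.ofReal_ne_top).1 h4

end NoCall

/-! ### The star -/

section Star

variable {V : Type*} [Fintype V] [MeasurableSpace V]

lemma law_lt_first_ring (G : SimpleGraph V) (x : V) {t : ℝ} (ht : 0 ≤ t) :
    law G {ω | t < (ω (x, 0)).1} = ENNReal.ofReal (Real.exp (-t)) := by
  have hT : MeasurableSet (Set.Ioi t ×ˢ (Set.univ : Set V)) := measurableSet_Ioi.prod .univ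
  have h := (measurePreserving_clock G x).measure_preimage
    (s := {w | w 0 ∈ Set.Ioi t ×ˢ (Set.univ : Set V)})
    (measurable_pi_apply 0 hT).nullMeasurableSet
  rw [clockLaw_first hT, Measure.prod_prod, measure_univ, mul_one, expMeasure_Ioi ht] at h
  rw [← h]
  congr 1
  ext ω
  simp

variable [MeasurableSingletonClass V]

lemma ae_law_adj (G : SimpleGraph V) (hG : ∀ x, 0 < deg G x) :
    ∀ᵐ ω ∂law G, ∀ x k, G.Adj x (ω (x, k)).2 := by
  filter_upwards [ae_law_call G] with ω hω x k
  exact adj_of_mem_support_callPMF G (hG x) (hω x k)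

variable (r : V)

/-- On the star, every call of a leaf goes to the centre. -/
lemma ae_law_starGraph_call (hV : 1 < Fintype.card V) :
    ∀ᵐ ω ∂law (SimpleGraph.starGraph r), ∀ x, x ≠ r → (ω (x, 0)).2 = r := by
  filter_upwards [ae_law_adj _ (deg_pos_of_connected (SimpleGraph.connected_starGraph r) hV)]
    with ω hω x hx
  have := hω x 0
  rw [SimpleGraph.starGraph_adj] at this
  tauto

lemma law_starGraph_notMem_le (hV : 1 < Fintype.card V) (v : V) {t : ℝ} (ht : 0 ≤ t) :
    law (SimpleGraph.starGraph r) {ω | r ∉ informedSet .pushPull {v} t ω} ≤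
      ENNReal.ofReal (Real.exp (-t)) := by
  rw [← law_lt_first_ring (SimpleGraph.starGraph r) v ht]
  refine measure_mono_ae ?_
  filter_upwards [ae_law_starGraph_call r hV, ae_law_pos _] with ω hω hpos hr
  by_contra hlt
  have hlt : (ω (v, 0)).1 ≤ t := not_lt.1 hlt
  refine hr ?_
  by_cases hv : v = r
  · exact .source _ _ hv.symm ht
  · have := InformedFrom.push (P := .pushPull) (ω := ω) (A := {v}) v 0 0 t rfl
      (.source _ _ rfl le_rfl) (by simpa [ringTime] using hpos (v, 0))
      (by simpa [ringTime] using hlt)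
    rwa [hω v hv] at this

lemma law_starGraph_lateEvent_le (hV : 1 < Fintype.card V) (P : Protocol) {B : Set V} (hB : r ∈ B)
    {t : ℝ} (ht : 0 ≤ t) :
    law (SimpleGraph.starGraph r) (lateEvent P B t) ≤
      Fintype.card V * ENNReal.ofReal (Real.exp (-t)) := by
  calc law (SimpleGraph.starGraph r) (lateEvent P B t)
      ≤ law (SimpleGraph.starGraph r) (⋃ x ∈ Finset.univ, {ω | t < (ω (x, 0)).1}) := by
        refine measure_mono_ae ?_
        filter_upwards [ae_law_starGraph_call r hV, ae_law_pos _] with ω hω hpos hlate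
        by_contra hlt
        have hlt : ∀ x, (ω (x, 0)).1 ≤ t := by
          intro x
          by_contra! h
          exact hlt (Set.mem_biUnion (Finset.mem_coe.2 (Finset.mem_univ x)) h)
        refine hlate (Set.eq_univ_of_forall fun x => ?_)
        by_cases hx : x = r
        · exact .source _ _ (hx ▸ hB) ht
        · exact .pull x 0 0 t (.source _ _ (by rwa [hω x hx]) le_rfl)
            (by simpa [ringTime] using hpos (x, 0)) (by simpa [ringTime] using hlt x)
    _ ≤ ∑ x, law (SimpleGraph.starGraph r) {ω | t < (ω (x, 0)).1} :=
        measure_biUnion_finset_le _ _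
    _ = _ := by simp [law_lt_first_ring _ _ ht]

/-- A time `t` to reach the centre, and a time `t` for all leaves to pull from it. -/
lemma law_starGraph_lateEvent_add_le (hV : 1 < Fintype.card V) (v : V) {t : ℝ} (ht : 0 ≤ t) :
    law (SimpleGraph.starGraph r) (lateEvent .pushPull {v} (t + t)) ≤
      (1 + Fintype.card V) * ENNReal.ofReal (Real.exp (-t)) := by
  have hm : MeasurableSet {ω : Realization V | r ∉ informedSet .pushPull {v} t ω} :=
    (measurableSet_mem_informedSet _ _ _ _).compl
  rw [law_lateEvent_eq_lintegral, lintegral_informedSet_add _ _ _ _ ht ht]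
  calc _ ≤ ∫⁻ ω, ({ω : Realization V | r ∉ informedSet .pushPull {v} t ω}.indicator 1 ω +
        Fintype.card V * ENNReal.ofReal (Real.exp (-t))) ∂law (SimpleGraph.starGraph r) := by
        refine lintegral_mono fun ω => ?_
        rw [← law_lateEvent_eq_lintegral]
        by_cases h : r ∈ informedSet .pushPull {v} t ω
        · exact (law_starGraph_lateEvent_le r hV .pushPull h ht).trans le_add_self
        · rw [Set.indicator_of_mem h]
          exact prob_le_one.trans le_self_add
    _ = law (SimpleGraph.starGraph r) {ω | r ∉ informedSet .pushPull {v} t ω} +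
        Fintype.card V * ENNReal.ofReal (Real.exp (-t)) := by
        rw [lintegral_add_right _ measurable_const, lintegral_indicator_one hm, lintegral_const,
          measure_univ, mul_one]
    _ ≤ _ := by
        rw [add_mul, one_mul]
        gcongr
        exact law_starGraph_notMem_le r hV v ht

lemma guaranteedSpreadTime_starGraph_le (hV : 3 ≤ Fintype.card V) :
    guaranteedSpreadTime .pushPull (SimpleGraph.starGraph r) ≤
      ENNReal.ofReal (6 * Real.log (Fintype.card V)) := by
  set n := Fintype.card V with hn
  have hn3 : (3 : ℝ) ≤ n := by exact_mod_cast hV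
  have hn0 : (0 : ℝ) < n := by linarith
  have hL : 1 ≤ Real.log n := by
    rw [Real.le_log_iff_exp_le hn0]
    linarith [Real.exp_one_lt_d9]
  set t := 2 * Real.log n + 1 with ht
  refine le_trans (b := ENNReal.ofReal (t + t)) ?_ (ENNReal.ofReal_le_ofReal (by linarith))
  refine guaranteedSpreadTime_le _ (by linarith) fun v => ?_
  refine (law_starGraph_lateEvent_add_le r (by omega) v (t := t) (by linarith)).trans ?_
  rw [← hn, ← ENNReal.ofReal_natCast n, ← ENNReal.ofReal_one,
    ← ENNReal.ofReal_add one_pos.le hn0.le, ← ENNReal.ofReal_mul (by linarith),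
    ← ENNReal.ofReal_inv_of_pos hn0]
  refine ENNReal.ofReal_le_ofReal ?_
  have hexp : Real.exp (-t) = (n : ℝ)⁻¹ * (n : ℝ)⁻¹ * (Real.exp 1)⁻¹ := by
    rw [ht, neg_add, Real.exp_add, Real.exp_neg 1, two_mul, neg_add, Real.exp_add, Real.exp_neg,
      Real.exp_log hn0]
  have he : 2 ≤ Real.exp 1 := by linarith [Real.add_one_le_exp (1 : ℝ)]
  have hkey : (1 + n) * (n : ℝ)⁻¹ * (Real.exp 1)⁻¹ ≤ 1 := by
    rw [mul_assoc, ← mul_inv, ← div_eq_mul_inv, div_le_one (by positivity)]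
    nlinarith
  calc (1 + n) * Real.exp (-t) = (n : ℝ)⁻¹ * ((1 + n) * (n : ℝ)⁻¹ * (Real.exp 1)⁻¹) := by
        rw [hexp]; ring
    _ ≤ (n : ℝ)⁻¹ * 1 := by gcongr
    _ = (n : ℝ)⁻¹ := mul_one _

end Star

/-! ### The path -/

section Path

open SimpleGraph (pathGraph)

variable {n : ℕ}

lemma deg_pathGraph_pos (hn : 2 ≤ n) (x : Fin n) : 0 < deg (pathGraph n) x := by
  obtain ⟨m, rfl⟩ : ∃ m, n = m + 1 := ⟨n - 1, by omega⟩
  exact deg_pos_of_connected (SimpleGraph.pathGraph_connected m)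
    (by rw [Fintype.card_fin]; omega) x

/-- If neither of two consecutive vertices rings, then the rumour does not pass between them. -/
lemma informedSet_pathGraph_subset {P : Protocol} {ω : Realization (Fin n)}
    (hpos : ∀ p, 0 < (ω p).1) (hadj : ∀ x k, (pathGraph n).Adj x (ω (x, k)).2) {B : Set (Fin n)}
    {q : ℕ} (hB : ∀ y ∈ B, y.val ≤ q) {δ : ℝ}
    (hq : ∀ x : Fin n, x.val = q ∨ x.val = q + 1 → δ < (ω (x, 0)).1) :
    ∀ y ∈ informedSet P B δ ω, y.val ≤ q := by
  refine informedSet_subset_of_forall_call (B := {y : Fin n | y.val ≤ q}) hB fun x k hk => ?_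
  have h1 : (ω (x, 0)).1 ≤ δ :=
    (le_clockRing (w := fun j => ω (x, j)) (fun j => hpos (x, j)) (Nat.zero_le k)).trans hk
  have h2 : ¬ (x.val = q ∨ x.val = q + 1) := fun h => absurd (hq x h) (not_lt.2 h1)
  have h3 := hadj x k
  rw [SimpleGraph.pathGraph_adj] at h3
  simp only [Set.mem_ofPred_eq]
  omega

open Classical in
/-- The largest vertex in `B`. -/
noncomputable def rightmost (B : Set (Fin n)) : ℕ := (Finset.univ.filter (· ∈ B)).sup Fin.val

lemma rightmost_le_iff {B : Set (Fin n)} {q : ℕ} : rightmost B ≤ q ↔ ∀ y ∈ B, y.val ≤ q := by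
  simp [rightmost]

lemma rightmost_le (B : Set (Fin n)) : rightmost B ≤ n := rightmost_le_iff.2 fun y _ => y.2.le

/-- The event that the clock of the vertex number `j` rings up to time `δ`. -/
def ringsBy (n : ℕ) (δ : ℝ) (j : ℕ) : Set (Realization (Fin n)) :=
  {ω | ∃ x : Fin n, x.val = j ∧ (ω (x, 0)).1 ≤ δ}

lemma ringsBy_eq (δ : ℝ) (x : Fin n) : ringsBy n δ x = {ω | (ω (x, 0)).1 ≤ δ} := by
  ext ω
  simp only [ringsBy, Set.mem_ofPred_eq]
  exact ⟨fun ⟨y, hy, h⟩ => by rwa [← Fin.ext hy], fun h => ⟨x, rfl, h⟩⟩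

lemma ringsBy_eq_empty (δ : ℝ) {j : ℕ} (hj : n ≤ j) : ringsBy n δ j = ∅ := by
  ext ω
  simp only [ringsBy, Set.mem_ofPred_eq, Set.mem_empty_iff_false, iff_false]
  rintro ⟨x, hx, -⟩
  have := x.2
  omega

lemma measurableSet_ringsBy (δ : ℝ) (j : ℕ) : MeasurableSet (ringsBy n δ j) := by
  rcases lt_or_ge j n with hj | hj
  · have := ringsBy_eq δ ⟨j, hj⟩
    simp only at this
    rw [this]
    exact measurableSet_le (by fun_prop) (by fun_prop)
  · rw [ringsBy_eq_empty δ hj]; exact .empty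

lemma law_first_rings_le (G : SimpleGraph (Fin n)) (s : Finset (Fin n)) {δ : ℝ} (hδ : 0 ≤ δ) :
    law G {ω | ∀ x ∈ s, (ω (x, 0)).1 ≤ δ} ≤ ENNReal.ofReal δ ^ s.card := by
  have hset : {ω : Realization (Fin n) | ∀ x ∈ s, (ω (x, 0)).1 ≤ δ} =
      {ω | ∀ x, (fun k => ω (x, k)) ∈
      (if x ∈ s then {w : ℕ → ℝ × Fin n | w 0 ∈ Set.Iic δ ×ˢ Set.univ} else Set.univ)} := by
    ext ω
    simp only [Set.mem_ofPred_eq]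
    refine forall_congr' fun x => ?_
    by_cases hx : x ∈ s <;> simp [hx]
  rw [hset, law_forall_clock, ← Finset.prod_subset (Finset.subset_univ s)
    fun x _ hx => by simp [hx], ← Finset.prod_const]
  refine Finset.prod_le_prod' fun x hx => ?_
  rw [if_pos hx, clockLaw_first (measurableSet_Iic.prod .univ), Measure.prod_prod, measure_univ,
    mul_one]
  exact expMeasure_Iic_le hδ

lemma law_ringsBy_le (G : SimpleGraph (Fin n)) {δ : ℝ} (hδ : 0 ≤ δ) (j : ℕ) :
    law G (ringsBy n δ j) ≤ ENNReal.ofReal δ := by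
  rcases lt_or_ge j n with hj | hj
  · have h := law_first_rings_le G {⟨j, hj⟩} hδ
    have h2 := ringsBy_eq δ ⟨j, hj⟩
    simp only at h2
    rw [h2]
    simpa using h
  · simp [ringsBy_eq_empty δ hj]

lemma law_ringsBy_inter_le (G : SimpleGraph (Fin n)) {δ : ℝ} (hδ : 0 ≤ δ) {i j : ℕ} (hij : i ≠ j) :
    law G (ringsBy n δ i ∩ ringsBy n δ j) ≤ ENNReal.ofReal δ ^ 2 := by
  rcases lt_or_ge j n with hj | hj
  · rcases lt_or_ge i n with hi | hi
    · have h := law_first_rings_le G {⟨i, hi⟩, ⟨j, hj⟩} hδ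
      rw [Finset.card_pair (by simpa using hij)] at h
      refine le_trans (measure_mono ?_) h
      rintro ω ⟨⟨x, hx, h1⟩, ⟨y, hy, h2⟩⟩ z hz
      rw [Finset.mem_insert, Finset.mem_singleton] at hz
      rcases hz with rfl | rfl
      · have : x = ⟨i, hi⟩ := Fin.ext hx
        rwa [← this]
      · have : y = ⟨j, hj⟩ := Fin.ext hy
        rwa [← this]
    · simp [ringsBy_eq_empty δ hi]
  · simp [ringsBy_eq_empty δ hj]

/-- In a short time `δ`, the rumour moves to the right by `8 * δ` on average. Beyond the rightmost
informed vertex `q`, the rumour moves only if `q` or `q + 1` rings, and it moves by more than two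
steps only if moreover `q + 2` or `q + 3` rings. -/
lemma lintegral_rightmost_le (hn : 2 ≤ n) (P : Protocol) (B : Set (Fin n)) {δ : ℝ} (hδ : 0 ≤ δ)
    (hδn : n * δ ≤ 1) :
    ∫⁻ ω, (rightmost (informedSet P B δ ω) : ℝ≥0∞) ∂law (pathGraph n) ≤
      rightmost B + ENNReal.ofReal (8 * δ) := by
  set q := rightmost B with hq
  have hB : ∀ y ∈ B, y.val ≤ q := rightmost_le_iff.1 le_rfl
  set R := ringsBy n δ with hR
  set E := R q ∪ R (q + 1) with hE
  set F := E ∩ (R (q + 2) ∪ R (q + 3)) with hF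
  have hRm : ∀ j, MeasurableSet (R j) := measurableSet_ringsBy δ
  have hEm : MeasurableSet E := (hRm _).union (hRm _)
  have hFm : MeasurableSet F := hEm.inter ((hRm _).union (hRm _))
  have hpt : ∀ᵐ ω ∂law (pathGraph n), (rightmost (informedSet P B δ ω) : ℝ≥0∞) ≤
      q + (E.indicator (fun _ => 2) ω + F.indicator (fun _ => (n : ℝ≥0∞)) ω) := by
    filter_upwards [ae_law_pos _, ae_law_adj _ (deg_pathGraph_pos hn)] with ω hpos hadj
    have hno : ∀ j, ω ∉ R j ∪ R (j + 1) → ∀ x : Fin n, x.val = j ∨ x.val = j + 1 →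
        δ < (ω (x, 0)).1 := by
      intro j hj x hx
      by_contra! hle
      rcases hx with hx | hx
      · exact hj (.inl ⟨x, hx, hle⟩)
      · exact hj (.inr ⟨x, hx, hle⟩)
    by_cases h1 : ω ∈ E
    · by_cases h2 : ω ∈ F
      · simp only [h1, h2, Set.indicator_of_mem]
        refine le_trans ?_ (le_add_self.trans le_add_self)
        exact_mod_cast rightmost_le _
      · simp only [h1, h2, Set.indicator_of_mem, Set.indicator_of_notMem, not_false_eq_true]
        have h3 := informedSet_pathGraph_subset (P := P) hpos hadj (q := q + 2)
          (fun y hy => (hB y hy).trans (by omega)) (hno (q + 2) fun h => h2 ⟨h1, h⟩)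
        rw [add_zero]
        exact_mod_cast rightmost_le_iff.2 h3
    · have h3 := informedSet_pathGraph_subset (P := P) hpos hadj hB (hno q h1)
      refine le_trans ?_ le_self_add
      exact_mod_cast rightmost_le_iff.2 h3
  have hEle : law (pathGraph n) E ≤ 2 * ENNReal.ofReal δ := by
    refine (measure_union_le _ _).trans ?_
    rw [two_mul]
    exact add_le_add (law_ringsBy_le _ hδ _) (law_ringsBy_le _ hδ _)
  have hFle : law (pathGraph n) F ≤ 4 * ENNReal.ofReal δ ^ 2 := by
    have hsub : F ⊆ ((R q ∩ R (q + 2)) ∪ (R q ∩ R (q + 3))) ∪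
        ((R (q + 1) ∩ R (q + 2)) ∪ (R (q + 1) ∩ R (q + 3))) := by
      rintro ω ⟨h1 | h1, h2 | h2⟩
      · exact .inl (.inl ⟨h1, h2⟩)
      · exact .inl (.inr ⟨h1, h2⟩)
      · exact .inr (.inl ⟨h1, h2⟩)
      · exact .inr (.inr ⟨h1, h2⟩)
    refine (measure_mono hsub).trans ((measure_union_le _ _).trans ?_)
    have h4 : 4 * ENNReal.ofReal δ ^ 2 = (ENNReal.ofReal δ ^ 2 + ENNReal.ofReal δ ^ 2) +
        (ENNReal.ofReal δ ^ 2 + ENNReal.ofReal δ ^ 2) := by ring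
    rw [h4]
    refine add_le_add ((measure_union_le _ _).trans ?_) ((measure_union_le _ _).trans ?_)
    · exact add_le_add (law_ringsBy_inter_le _ hδ (by omega))
        (law_ringsBy_inter_le _ hδ (by omega))
    · exact add_le_add (law_ringsBy_inter_le _ hδ (by omega))
        (law_ringsBy_inter_le _ hδ (by omega))
  refine (lintegral_mono_ae hpt).trans ?_
  rw [lintegral_add_left measurable_const, lintegral_const, measure_univ, mul_one,
    lintegral_add_left (measurable_const.indicator hEm), lintegral_indicator_const hEm,
    lintegral_indicator_const hFm]
  gcongr
  calc 2 * law (pathGraph n) E + n * law (pathGraph n) F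
      ≤ 2 * (2 * ENNReal.ofReal δ) + n * (4 * ENNReal.ofReal δ ^ 2) := by gcongr
    _ = ENNReal.ofReal (4 * δ + 4 * δ * (n * δ)) := by
        rw [ENNReal.ofReal_add (by positivity) (by positivity), ENNReal.ofReal_mul (by positivity),
          ENNReal.ofReal_mul (by positivity), ENNReal.ofReal_mul (by positivity),
          ENNReal.ofReal_mul (by positivity), ENNReal.ofReal_natCast, ENNReal.ofReal_ofNat]
        ring
    _ ≤ ENNReal.ofReal (8 * δ) := by
        refine ENNReal.ofReal_le_ofReal ?_
        nlinarith

lemma lintegral_rightmost_nat_mul_le (hn : 2 ≤ n) (P : Protocol) (v : Fin n) (hv : v.val = 0)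
    {δ : ℝ} (hδ : 0 ≤ δ) (hδn : n * δ ≤ 1) (k : ℕ) :
    ∫⁻ ω, (rightmost (informedSet P {v} (k * δ) ω) : ℝ≥0∞) ∂law (pathGraph n) ≤
      ENNReal.ofReal (k * (8 * δ)) := by
  induction k with
  | zero =>
    refine lintegral_law_le _ ?_
    filter_upwards [ae_law_pos _] with ω hω
    rw [Nat.cast_zero, zero_mul, informedSet_zero hω]
    have : rightmost {v} ≤ 0 := rightmost_le_iff.2 (by simp [hv])
    simpa using this
  | succ k ih =>
    rw [Nat.cast_succ, add_mul, one_mul, lintegral_informedSet_add _ P {v}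
      (fun B => (rightmost B : ℝ≥0∞)) (by positivity) hδ]
    refine (lintegral_mono fun ω => lintegral_rightmost_le hn P _ hδ hδn).trans ?_
    rw [lintegral_add_right _ measurable_const, lintegral_const, measure_univ, mul_one, add_mul,
      one_mul, ENNReal.ofReal_add (by positivity) (by positivity)]
    gcongr

/-- At a time of order `n / 16`, the expected position of the rightmost informed vertex is at most
`(n - 1) / 2`, so the end of the path is uninformed with probability at least `1 / 2`. -/
lemma avgSpreadTime_pathGraph_ge (hn : 7 ≤ n) (P : Protocol) :
    ENNReal.ofReal (1 / 64 * n) ≤ avgSpreadTime P (pathGraph n) := by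
  have hn7 : (7 : ℝ) ≤ n := by exact_mod_cast hn
  have hn0 : (0 : ℝ) < n := by linarith
  set v : Fin n := ⟨0, by omega⟩ with hv
  set δ : ℝ := 1 / n with hδ
  set k := n * (n - 1) / 16 with hk
  have hk1 : (16 * k : ℝ) ≤ n * (n - 1) := by
    have : 16 * k ≤ n * (n - 1) := Nat.mul_div_le _ _
    have h2 : ((n - 1 : ℕ) : ℝ) = n - 1 := by rw [Nat.cast_sub (by omega)]; simp
    rw [← h2]
    exact_mod_cast this
  have hk2 : (n * (n - 1) : ℝ) ≤ 16 * (k + 1) := by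
    have : n * (n - 1) ≤ 16 * (k + 1) := by omega
    have h2 : ((n - 1 : ℕ) : ℝ) = n - 1 := by rw [Nat.cast_sub (by omega)]; simp
    rw [← h2]
    exact_mod_cast this
  set μ := law (pathGraph n) with hμ
  set f : Realization (Fin n) → ℝ≥0∞ := fun ω => rightmost (informedSet P {v} (k * δ) ω) with hf
  have hfm : Measurable f := (Measurable.of_discrete
    (f := fun B : Set (Fin n) => (rightmost B : ℝ≥0∞))).comp (measurable_informedSet P {v} (k * δ))
  have hmarkov := mul_meas_ge_le_lintegral (μ := μ) hfm ((n - 1 : ℕ) : ℝ≥0∞)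
  have hle := hmarkov.trans (lintegral_rightmost_nat_mul_le (by omega) P v rfl
    (δ := δ) (by positivity) (by rw [hδ]; field_simp; rfl) k)
  have hsub : (lateEvent P {v} (k * δ))ᶜ ⊆ {ω | ((n - 1 : ℕ) : ℝ≥0∞) ≤ f ω} := by
    intro ω hω
    have hω : informedSet P {v} (k * δ) ω = Set.univ := not_not.1 hω
    have h := rightmost_le_iff.1 (le_refl (rightmost (informedSet P {v} (k * δ) ω)))
      ⟨n - 1, by omega⟩ (hω ▸ Set.mem_univ _)
    simp only [Set.mem_ofPred_eq, hf]
    exact_mod_cast h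
  have hhalf : μ.real (lateEvent P {v} (k * δ))ᶜ ≤ 1 / 2 := by
    have h1 := (mul_le_mul' le_rfl (measure_mono (μ := μ) hsub)).trans hle
    rw [← ofReal_measureReal, ← ENNReal.ofReal_natCast, ← ENNReal.ofReal_mul (by positivity),
      ENNReal.ofReal_le_ofReal_iff (by positivity), Nat.cast_sub (by omega), Nat.cast_one] at h1
    have h2 : (k * (8 * δ) : ℝ) ≤ (n - 1) * (1 / 2) := by
      rw [hδ, mul_one_div, ← mul_div_assoc, div_le_iff₀ hn0]
      linarith
    exact le_of_mul_le_mul_left (h1.trans h2) (by linarith)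
  have hlate : ENNReal.ofReal (1 / 2) ≤ μ (lateEvent P {v} (k * δ)) := by
    rw [probReal_compl_eq_one_sub (measurableSet_lateEvent _ _ _)] at hhalf
    rw [← ofReal_measureReal]
    exact ENNReal.ofReal_le_ofReal (by linarith)
  refine le_trans ?_ ((ofReal_mul_law_lateEvent_le (pathGraph n) P v (k * δ)).trans
    (lintegral_le_avgSpreadTime _ P v))
  refine le_trans ?_ (mul_le_mul' le_rfl hlate)
  rw [← ENNReal.ofReal_mul (by positivity)]
  refine ENNReal.ofReal_le_ofReal ?_
  have h3 : (n : ℝ) / 32 ≤ k * δ := by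
    rw [hδ, mul_one_div, div_le_div_iff₀ (by norm_num) hn0]
    nlinarith
  linarith

end Path

/-! ### The double star -/

section DoubleStar

variable {n : ℕ}

lemma doubleStar_adj {i j : Fin n} : (doubleStar n).Adj i j ↔ i ≠ j ∧
    (((i.val = 0 ∧ j.val = 1) ∨ (2 ≤ j.val ∧ i.val = j.val % 2)) ∨
      ((j.val = 0 ∧ i.val = 1) ∨ (2 ≤ i.val ∧ j.val = i.val % 2))) := by
  simp [doubleStar]

lemma doubleStar_connected (hn : 2 ≤ n) : (doubleStar n).Connected := by
  have h1 : (doubleStar n).Reachable ⟨1, by omega⟩ ⟨0, by omega⟩ := by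
    refine SimpleGraph.Adj.reachable ?_
    rw [doubleStar_adj]
    simp
  have key : ∀ j : Fin n, (doubleStar n).Reachable j ⟨0, by omega⟩ := by
    intro j
    by_cases hj : 2 ≤ j.val
    · have hadj : (doubleStar n).Adj j ⟨j.val % 2, by omega⟩ := by
        rw [doubleStar_adj]
        refine ⟨fun h => ?_, .inr (.inr ⟨hj, rfl⟩)⟩
        have := congrArg Fin.val h
        simp only at this
        omega
      refine hadj.reachable.trans ?_
      rcases Nat.mod_two_eq_zero_or_one j.val with h | h
      · simp only [h]; exact .refl _
      · simp only [h]; exact h1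
    · rcases (show j.val = 0 ∨ j.val = 1 by omega) with h | h
      · rw [show j = ⟨0, by omega⟩ from Fin.ext h]
      · rw [show j = ⟨1, by omega⟩ from Fin.ext h]; exact h1
  have : Nonempty (Fin n) := ⟨⟨0, by omega⟩⟩
  exact ⟨fun i j => (key i).trans (key j).symm⟩

/-- Both centres have at least `n / 4` neighbours. -/
lemma deg_doubleStar_ge (hn : 8 ≤ n) {i : Fin n} (hi : i.val < 2) :
    (n : ℝ) / 4 ≤ deg (doubleStar n) i := by
  have hcard : (n - 3) / 2 ≤ deg (doubleStar n) i := by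
    have h := Finset.card_le_card_of_injOn (s := Finset.univ)
      (t := nbrs (doubleStar n) i Set.univ)
      (fun j : Fin ((n - 3) / 2) => (⟨2 * j.val + 2 + i.val, by omega⟩ : Fin n))
      (fun j _ => by
        simp only [Finset.mem_coe, mem_nbrs, Set.mem_univ, and_true, doubleStar_adj]
        refine ⟨fun h => ?_, .inl (.inr ⟨by omega, by omega⟩)⟩
        have := congrArg Fin.val h
        simp only at this
        omega)
      (fun j _ k _ h => by
        have := congrArg Fin.val h
        simp only at this
        exact Fin.ext (by omega))
    simpa [deg] using h
  have h2 : n ≤ 4 * deg (doubleStar n) i := by omega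
  have h3 : (n : ℝ) ≤ 4 * deg (doubleStar n) i := by exact_mod_cast h2
  linarith

/-- If no call passes between the two centres, then the rumour stays on one side. The calls between
the centres occur at a rate of order `1 / n`. -/
lemma law_doubleStar_lateEvent_ge (hn : 8 ≤ n) (P : Protocol) {v : Fin n} (hv : v.val = 0) {t : ℝ}
    (ht : 0 ≤ t) :
    ENNReal.ofReal (Real.exp (-(8 * t / n))) ≤ law (doubleStar n) (lateEvent P {v} t) := by
  have hn0 : (0 : ℝ) < n := by exact_mod_cast (show 0 < n by omega)
  have hdeg := deg_pos_of_connected (doubleStar_connected (n := n) (by omega))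
    (by rw [Fintype.card_fin]; omega)
  set a : Fin n := ⟨0, by omega⟩ with ha
  set b : Fin n := ⟨1, by omega⟩ with hb
  have hab : a ≠ b := by simp [ha, hb]
  set B : Fin n → Set (Fin n) := fun x => if x = a then {b} else if x = b then {a} else ∅ with hB
  have hsum : ∑ x, (callPMF (doubleStar n) x).toMeasure.real (B x) ≤ 8 / n := by
    have h1 : ∀ x, (callPMF (doubleStar n) x).toMeasure.real (B x) =
        (if x = a then callRate (doubleStar n) a b else 0) +
        (if x = b then callRate (doubleStar n) b a else 0) := by
      intro x
      by_cases hx : x = a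
      · subst hx; simp [hB, hab, callRate]
      · by_cases hx' : x = b
        · subst hx'; simp [hB, hab.symm, callRate]
        · simp [hB, hx, hx']
    have h2 : ∀ x y : Fin n, x.val < 2 → callRate (doubleStar n) x y ≤ 4 / n := by
      intro x y hx
      refine (callRate_le _ y (hdeg x)).trans ?_
      have := one_div_le_one_div_of_le (by positivity) (deg_doubleStar_ge hn hx)
      rwa [one_div_div] at this
    simp_rw [h1, Finset.sum_add_distrib]
    simp only [Finset.sum_ite_eq', Finset.mem_univ, if_true]
    have h3 : (8 : ℝ) / n = 4 / n + 4 / n := by ring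
    rw [h3]
    exact add_le_add (h2 a b (by simp [ha])) (h2 b a (by simp [hb]))
  calc ENNReal.ofReal (Real.exp (-(8 * t / n)))
      ≤ law (doubleStar n) (noCall B t) := by
        rw [law_noCall _ _ ht]
        refine ENNReal.ofReal_le_ofReal (Real.exp_le_exp.2 (neg_le_neg ?_))
        calc _ ≤ t * (8 / n) := by gcongr
          _ = 8 * t / n := by ring
    _ ≤ _ := by
        refine measure_mono_ae ?_
        filter_upwards [ae_law_adj _ hdeg] with ω hadj hω huniv
        have hsub : informedSet P {v} t ω ⊆ {y | y.val % 2 = 0} := by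
          refine informedSet_subset_of_forall_call (by simp [hv]) fun x k hk => ?_
          have h1 := hω x k hk
          have h2 := hadj x k
          rw [doubleStar_adj] at h2
          simp only [Set.mem_ofPred_eq]
          have h3 : x.val = 0 → (ω (x, k)).2.val ≠ 1 := by
            intro hx hy
            have hx : x = a := Fin.ext hx
            have hy : (ω (x, k)).2 = b := Fin.ext hy
            simp [hB, hx] at h1
            exact h1 (hx ▸ hy)
          have h4 : x.val = 1 → (ω (x, k)).2.val ≠ 0 := by
            intro hx hy
            have hx : x = b := Fin.ext hx
            have hy : (ω (x, k)).2 = a := Fin.ext hy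
            simp [hB, hx, hab.symm] at h1
            exact h1 (hx ▸ hy)
          omega
        have hbin : b ∈ informedSet P {v} t ω := huniv ▸ Set.mem_univ b
        simpa [hb] using hsub hbin

lemma guaranteedSpreadTime_doubleStar_ge (hn : 8 ≤ n) (P : Protocol) :
    ENNReal.ofReal (n * Real.log n / 9) ≤ guaranteedSpreadTime P (doubleStar n) := by
  have hn8 : (8 : ℝ) ≤ n := by exact_mod_cast hn
  have hn0 : (0 : ℝ) < n := by linarith
  have hL : 0 < Real.log n := Real.log_pos (by linarith)
  refine le_guaranteedSpreadTime _ ⟨0, by omega⟩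
    (lt_of_lt_of_le ?_ (law_doubleStar_lateEvent_ge hn P rfl (by positivity)))
  rw [Fintype.card_fin, ← ENNReal.ofReal_natCast, ← ENNReal.ofReal_inv_of_pos hn0]
  refine (ENNReal.ofReal_lt_ofReal_iff (Real.exp_pos _)).2 ?_
  have h : (n : ℝ)⁻¹ = Real.exp (-Real.log n) := by rw [Real.exp_neg, Real.exp_log hn0]
  rw [h, Real.exp_lt_exp, neg_lt_neg_iff]
  have h2 : 8 * (n * Real.log n / 9) / n = 8 / 9 * Real.log n := by field_simp
  linarith

end DoubleStar

/-! ### Bounds for all connected graphs -/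

section Bounds

lemma exists_log_lt_avgSpreadTime : ∃ N : ℕ, ∀ (V : Type*) [Fintype V] [MeasurableSpace V]
    [MeasurableSingletonClass V] (G : SimpleGraph V) (n : ℕ), Fintype.card V = n → N ≤ n →
      G.Connected → ∀ P : Protocol,
      ENNReal.ofReal (1 / 5 * Real.log n) < avgSpreadTime P G ∧
      ENNReal.ofReal (1 / 5 * Real.log n) ≤ guaranteedSpreadTime P G := by
  obtain ⟨N, hN⟩ := exists_law_lateEvent_ge
  refine ⟨N, fun V _ _ _ G n hV hn hG P => ?_⟩
  obtain ⟨hn10, hL, h⟩ := hN n hn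
  have hV1 : 1 < Fintype.card V := by
    have : (1 : ℝ) < n := by linarith
    rw [hV]; exact_mod_cast this
  have hlate := h V G hV (deg_pos_of_connected hG hV1) P
  obtain ⟨v⟩ := hG.nonempty
  constructor
  · calc ENNReal.ofReal (1 / 5 * Real.log n)
        < ENNReal.ofReal (9 / 40 * Real.log n * (9 / 10)) :=
          (ENNReal.ofReal_lt_ofReal_iff (by positivity)).2 (by linarith)
      _ = ENNReal.ofReal (9 / 40 * Real.log n) * ENNReal.ofReal (9 / 10) :=
          ENNReal.ofReal_mul (by positivity)
      _ ≤ ENNReal.ofReal (9 / 40 * Real.log n) *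
          law G (lateEvent P {v} (9 / 40 * Real.log n)) := by gcongr; exact hlate v
      _ ≤ avgSpreadTime P G :=
          (ofReal_mul_law_lateEvent_le G P v _).trans (lintegral_le_avgSpreadTime G P v)
  · refine (ENNReal.ofReal_le_ofReal (by linarith)).trans
      (le_guaranteedSpreadTime (t := 9 / 40 * Real.log n) G v ((?_ : _ < _).trans_le (hlate v)))
    have hn0 : (0 : ℝ) < n := by linarith
    rw [hV, ← ENNReal.ofReal_natCast, ← ENNReal.ofReal_inv_of_pos hn0]
    refine (ENNReal.ofReal_lt_ofReal_iff (by norm_num)).2 ?_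
    rw [inv_lt_comm₀ hn0 (by norm_num)]
    linarith

lemma avgSpreadTime_lt_linear {V : Type*} [Fintype V] [MeasurableSpace V]
    [MeasurableSingletonClass V] {G : SimpleGraph V} (hG : G.Connected) (P : Protocol) :
    avgSpreadTime P G < ENNReal.ofReal (4 * Fintype.card V) := by
  have : 0 < Fintype.card V := Fintype.card_pos_iff.2 hG.nonempty
  refine (avgSpreadTime_le_linear hG P).trans_lt
    ((ENNReal.ofReal_lt_ofReal_iff (by positivity)).2 ?_)
  linarith

end Bounds

end Rumour

open Rumour in
theorem theorem1 :
    -- the bounds, for all large enough connected graphs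
    (∃ N : ℕ, ∀ (V : Type*) [Fintype V] [MeasurableSpace V] [MeasurableSingletonClass V]
      (G : SimpleGraph V) (n : ℕ), Fintype.card V = n → N ≤ n → G.Connected →
        ENNReal.ofReal (1 - 1 / (n : ℝ)) * avgSpreadTime .pushPull G
            ≤ guaranteedSpreadTime .pushPull G ∧
        guaranteedSpreadTime .pushPull G
            ≤ ENNReal.ofReal (Real.exp 1 * Real.log n) * avgSpreadTime .pushPull G ∧
        ENNReal.ofReal (1 / 5 * Real.log n) < avgSpreadTime .pushPull G ∧
        avgSpreadTime .pushPull G < ENNReal.ofReal (4 * n) ∧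
        avgSpreadTime .pullOnly G < ENNReal.ofReal (4 * n) ∧
        ENNReal.ofReal (1 / 5 * Real.log n) ≤ guaranteedSpreadTime .pushPull G ∧
        guaranteedSpreadTime .pushPull G ≤ ENNReal.ofReal (4 * Real.exp 1 * n * Real.log n)) ∧
    -- the star: the lower bounds are tight up to constant factors
    (∃ C : ℝ, 0 < C ∧ ∀ᶠ n : ℕ in atTop, ∀ r : Fin n,
        guaranteedSpreadTime .pushPull (SimpleGraph.starGraph r)
            ≤ ENNReal.ofReal C * avgSpreadTime .pushPull (SimpleGraph.starGraph r) ∧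
        avgSpreadTime .pushPull (SimpleGraph.starGraph r) ≤ ENNReal.ofReal (C * Real.log n) ∧
        guaranteedSpreadTime .pushPull (SimpleGraph.starGraph r)
            ≤ ENNReal.ofReal (C * Real.log n)) ∧
    -- the path: the linear upper bounds on the average spread times are tight up to constants
    (∃ c : ℝ, 0 < c ∧ ∀ᶠ n : ℕ in atTop,
        ENNReal.ofReal (c * n) ≤ avgSpreadTime .pushPull (SimpleGraph.pathGraph n) ∧
        ENNReal.ofReal (c * n) ≤ avgSpreadTime .pullOnly (SimpleGraph.pathGraph n)) ∧
    -- the double star: the upper bounds on the guaranteed spread time are tight up to constants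
    (∃ c : ℝ, 0 < c ∧ ∀ᶠ n : ℕ in atTop, (doubleStar n).Connected ∧
        ENNReal.ofReal (c * Real.log n) * avgSpreadTime .pushPull (doubleStar n)
            ≤ guaranteedSpreadTime .pushPull (doubleStar n) ∧
        ENNReal.ofReal (c * n * Real.log n) ≤ guaranteedSpreadTime .pushPull (doubleStar n)) := by
  refine ⟨?_, ⟨30, by norm_num, ?_⟩, ⟨1 / 64, by norm_num, ?_⟩, ⟨1 / 36, by norm_num, ?_⟩⟩
  · obtain ⟨N, hN⟩ := exists_log_lt_avgSpreadTime
    refine ⟨max N ⌈Real.exp 5⌉₊, fun V _ _ _ G n hV hn hG => ?_⟩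
    obtain ⟨h1, h2⟩ := hN V G n hV ((le_max_left _ _).trans hn) hG .pushPull
    have hn5 : Real.exp 5 ≤ n :=
      (Nat.le_ceil _).trans (by exact_mod_cast (le_max_right _ _).trans hn)
    have hn0 : (0 : ℝ) < n := (Real.exp_pos 5).trans_le hn5
    have hlog : 5 ≤ Real.log n := (Real.le_log_iff_exp_le hn0).2 hn5
    subst hV
    have hlin := avgSpreadTime_lt_linear hG .pushPull
    have hgst := guaranteedSpreadTime_le_avgSpreadTime G .pushPull hlog
      (ne_bot_of_gt h1) (ne_top_of_lt hlin)
    refine ⟨avgSpreadTime_le_guaranteedSpreadTime G .pushPull, hgst, h1, hlin,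
      avgSpreadTime_lt_linear hG .pullOnly, h2, ?_⟩
    calc guaranteedSpreadTime .pushPull G
        ≤ ENNReal.ofReal (Real.exp 1 * Real.log (Fintype.card V)) *
          ENNReal.ofReal (4 * Fintype.card V) := hgst.trans (by gcongr)
      _ = ENNReal.ofReal (4 * Real.exp 1 * Fintype.card V * Real.log (Fintype.card V)) := by
          rw [← ENNReal.ofReal_mul (by positivity)]
          congr 1
          ring
  · obtain ⟨N, hN⟩ := exists_log_lt_avgSpreadTime
    filter_upwards [eventually_ge_atTop (max N 3)] with n hn r
    have hn3 : 3 ≤ n := (le_max_right _ _).trans hn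
    have hn3' : (3 : ℝ) ≤ n := by exact_mod_cast hn3
    have hL : 0 < Real.log n := Real.log_pos (by linarith)
    have hconn : (SimpleGraph.starGraph r).Connected := SimpleGraph.connected_starGraph r
    obtain ⟨h1, -⟩ := hN (Fin n) (SimpleGraph.starGraph r) n (Fintype.card_fin n)
      ((le_max_left _ _).trans hn) hconn .pushPull
    have hgst := guaranteedSpreadTime_starGraph_le r (by rwa [Fintype.card_fin])
    have havg := (avgSpreadTime_le_guaranteedSpreadTime (SimpleGraph.starGraph r) .pushPull).trans
      hgst
    rw [Fintype.card_fin] at hgst havg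
    refine ⟨?_, ?_, hgst.trans (ENNReal.ofReal_le_ofReal (by linarith))⟩
    · calc _ ≤ ENNReal.ofReal (6 * Real.log n) := hgst
        _ = ENNReal.ofReal 30 * ENNReal.ofReal (1 / 5 * Real.log n) := by
            rw [← ENNReal.ofReal_mul (by norm_num)]; congr 1; ring
        _ ≤ _ := by gcongr
    · have hhalf : ENNReal.ofReal (1 / 2) ≤ ENNReal.ofReal (1 - 1 / (n : ℝ)) := by
        refine ENNReal.ofReal_le_ofReal ?_
        have : 1 / (n : ℝ) ≤ 1 / 3 := one_div_le_one_div_of_le (by norm_num) hn3'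
        linarith
      calc avgSpreadTime .pushPull (SimpleGraph.starGraph r)
          = ENNReal.ofReal 2 * (ENNReal.ofReal (1 / 2) *
              avgSpreadTime .pushPull (SimpleGraph.starGraph r)) := by
            rw [← mul_assoc, ← ENNReal.ofReal_mul (by norm_num)]; norm_num
        _ ≤ ENNReal.ofReal 2 * ENNReal.ofReal (6 * Real.log n) := by
            gcongr
            exact (mul_le_mul' hhalf le_rfl).trans havg
        _ ≤ _ := by
            rw [← ENNReal.ofReal_mul (by norm_num)]
            exact ENNReal.ofReal_le_ofReal (by linarith)
  · filter_upwards [eventually_ge_atTop 7] with n hn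
    exact ⟨avgSpreadTime_pathGraph_ge hn _, avgSpreadTime_pathGraph_ge hn _⟩
  · filter_upwards [eventually_ge_atTop 8] with n hn
    have hn8 : (8 : ℝ) ≤ n := by exact_mod_cast hn
    have hL : 0 < Real.log n := Real.log_pos (by linarith)
    have hconn := doubleStar_connected (n := n) (by omega)
    have hge := guaranteedSpreadTime_doubleStar_ge hn .pushPull
    have hlin := avgSpreadTime_lt_linear hconn .pushPull
    rw [Fintype.card_fin] at hlin
    refine ⟨hconn, le_trans ?_ hge, le_trans (ENNReal.ofReal_le_ofReal ?_) hge⟩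
    · calc _ ≤ ENNReal.ofReal (1 / 36 * Real.log n) * ENNReal.ofReal (4 * n) := by gcongr
        _ = ENNReal.ofReal (n * Real.log n / 9) := by
            rw [← ENNReal.ofReal_mul (by positivity)]
            congr 1
            ring
    · have : 0 < n * Real.log n := by positivity
      linarith
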